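/- Let $\mathcal H \neq \{0\}$ be a separable complex Hilbert space, let $\mathcal L(\mathcal H)$ be the bounded operators on $\mathcal H$, and let $\mathcal S(\mathcal H)$ be the set of states, i.e. of positive operators of trace one. A POVM on a measurable space $\Omega$ is a map $M$ from the measurable subsets of $\Omega$ to $\mathcal L(\mathcal H)$ such that $X \mapsto \operatorname{tr}[\rho M(X)]$ is a probability measure for every $\rho \in \mathcal S(\mathcal H)$. A measurement is a POVM $M$ on a standard Borel space $\Omega_M$. For a set $\mathcal M$ of measurements, $E(\mathcal M) = \{M(X) : M \in \mathcal M,\ X \subseteq \Omega_M \text{ measurable}\}$ is the set of its effects. The set $\mathcal M$ is called contextuality non-confirming (in the non-normal sense) if there are a POVM $G$ on a standard Borel space $\Omega$, a faithful state $\rho_0 \in \mathcal S(\mathcal H)$ (that is, $A \ge 0$ and $\operatorname{tr}[\rho_0 A] = 0$ imply $A = 0$), and a positive linear map $T : \mathcal L(\mathcal H) \to L^\infty(\Omega, \operatorname{tr}[\rho_0 G(\cdot)])$ with $T(I) = 1$, such that $$\operatorname{tr}[\rho M(X)] = \int_\Omega T(M(X))(\lambda)\, d\operatorname{tr}[\rho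 G(\lambda)]$$ for all $M \in \mathcal M$, all $\rho \in \mathcal S(\mathcal H)$ and all measurable $X \subseteq \Omega_M$. (No normality of $T$ is required.) **Corollary.** Let $N \subseteq \mathcal L(\mathcal H)$ be a commutative von Neumann algebra on a separable Hilbert space. By this we mean that $N$ is a linear subspace of $\mathcal L(\mathcal H)$ containing $I$ and carries a product that, together with the norm, the involution and the unit $I$ inherited from $\mathcal L(\mathcal H)$, makes it isomorphic to a commutative von Neumann algebra of operators on some separable Hilbert space $\mathcal K$. (The product need not be the operator product of $\mathcal L(\mathcal H)$; every commutative von Neumann subalgebra of $\mathcal L(\mathcal H)$ containing $I$ is an instance, with $\mathcal K = \mathcal H$.) If $\mathcal M$ is a set of measurements on $\mathcal H$ with $E(\mathcal M) \subseteq N$, then $\mathcal M$ is contextuality non-confirming in the non-normal sense. -/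

import Mathlib

open MeasureTheory
open scoped ComplexOrder InnerProductSpace

noncomputable section

namespace Contextuality

/-- The bounded operators on the complex Hilbert space `H`. -/
abbrev Op (H : Type*) [NormedAddCommGroup H] [InnerProductSpace ℂ H] : Type _ := H →L[ℂ] H

section Trace

variable (H : Type*) [NormedAddCommGroup H] [InnerProductSpace ℂ H] [CompleteSpace H]

/-- The index set of a fixed orthonormal basis of `H`. -/
def basisIndex : Set H := (exists_hilbertBasis ℂ H).choose

/-- A fixed orthonormal basis of `H`. -/
def onb : HilbertBasis (basisIndex H) ℂ H := (exists_hilbertBasis ℂ H).choose_spec.choose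

variable {H}

/-- The trace `∑ᵢ ⟪eᵢ, A eᵢ⟫`. It is only used for operators `A` that are positive or
trace class, where it does not depend on the orthonormal basis `e`. -/
def trace (A : Op H) : ℂ := ∑' i : basisIndex H, ⟪onb H i, A (onb H i)⟫_ℂ

end Trace

section Quantum

variable (H : Type*) [NormedAddCommGroup H] [InnerProductSpace ℂ H] [CompleteSpace H]

/-- Quantum states: positive operators of trace one. (A positive operator that is not trace
class has a divergent trace series, whose sum is `0` by convention, so it is not a state.) -/
structure State where
  op : Op H
  pos : op.IsPositive
  trace_eq_one : trace op = 1

variable {H}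

/-- A state `ρ` is faithful if `tr(ρ A) = 0` for `A ≥ 0` implies `A = 0`. -/
def State.Faithful (ρ : State H) : Prop :=
  ∀ A : Op H, A.IsPositive → trace (ρ.op * A) = 0 → A = 0

variable (H)

/-- A positive operator valued measure on the measurable space `Ω`: for every state `ρ`, the
map `X ↦ tr(ρ M(X))` is a probability measure on the measurable sets. Only the values on
measurable sets are meaningful. -/
structure POVM (Ω : Type*) [MeasurableSpace Ω] where
  effect : Set Ω → Op H
  exists_probability : ∀ ρ : State H, ∃ μ : Measure Ω, IsProbabilityMeasure μ ∧
    ∀ X, MeasurableSet X → trace (ρ.op * effect X) = ((μ.real X : ℝ) : ℂ)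

/-- An observable (measurement) of the system `H`: a POVM together with its outcome space,
which is a standard Borel space. -/
structure Observable where
  Ω : Type*
  [measurableSpace : MeasurableSpace Ω]
  [standardBorel : StandardBorelSpace Ω]
  povm : POVM H Ω

attribute [instance] Observable.measurableSpace Observable.standardBorel

variable {H}

/-- The effects of a set of measurements: the union of the ranges of its POVMs. -/
def effects (ℳ : Set (Observable H)) : Set (Op H) :=
  {E | ∃ M ∈ ℳ, ∃ X : Set M.Ω, MeasurableSet X ∧ M.povm.effect X = E}

variable {Ω : Type*} [MeasurableSpace Ω]

/-- The outcome distribution `X ↦ tr(ρ G(X))`. -/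
def POVM.measure (G : POVM H Ω) (ρ : State H) : Measure Ω := (G.exists_probability ρ).choose

theorem POVM.isProbabilityMeasure_measure (G : POVM H Ω) (ρ : State H) :
    IsProbabilityMeasure (G.measure ρ) := (G.exists_probability ρ).choose_spec.1

theorem POVM.trace_mul_effect (G : POVM H Ω) (ρ : State H) {X : Set Ω} (hX : MeasurableSet X) :
    trace (ρ.op * G.effect X) = (((G.measure ρ).real X : ℝ) : ℂ) :=
  (G.exists_probability ρ).choose_spec.2 X hX

/-- A `G`-measurement response with respect to the state `ρ₀`: a positive unital linear map
from the bounded operators to the complex space `L^∞(Ω, tr(ρ₀ G))`. No normality is asked. -/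
structure MeasurementResponse (G : POVM H Ω) (ρ₀ : State H) where
  toLinearMap : Op H →ₗ[ℂ] Lp ℂ ⊤ (G.measure ρ₀)
  pos : ∀ A : Op H, A.IsPositive → ∀ᵐ x ∂(G.measure ρ₀), 0 ≤ toLinearMap A x
  unital : ∀ᵐ x ∂(G.measure ρ₀), toLinearMap 1 x = 1

/-- A set of measurements is contextuality non-confirming in the non-normal sense if there are
a POVM `G` on a standard Borel space, a faithful state `ρ₀` and a `G`-measurement response `T`
with `tr(ρ M(X)) = ∫ T(M(X)) d tr(ρ G)` for all `M` in the set, all states `ρ` and all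
measurable `X`. -/
def NonNormalNonConfirming (ℳ : Set (Observable H)) : Prop :=
  ∃ (Ω : Type) (_ : MeasurableSpace Ω) (_ : StandardBorelSpace Ω) (G : POVM H Ω)
    (ρ₀ : State H) (_ : ρ₀.Faithful) (T : MeasurementResponse G ρ₀),
    ∀ M ∈ ℳ, ∀ ρ : State H, ∀ X : Set M.Ω, MeasurableSet X →
      trace (ρ.op * M.povm.effect X) =
        ∫ x, T.toLinearMap (M.povm.effect X) x ∂(G.measure ρ)

end Quantum

/-- The linear space `N` of operators on `H` is a commutative von Neumann algebra on the Hilbert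
space `K`: it contains the identity operator of `H` and carries a product which, with the norm,
the involution and the unit that `N` has as a space of operators on `H`, makes it isomorphic to
a commutative von Neumann algebra `A` of operators on `K`. The product of `N` is the one
transported from `A` along the isomorphism `e`; it may but need not be the composition of
operators on `H`. -/
def IsCommVonNeumannAlgebraOn
    (K : Type*) [NormedAddCommGroup K] [InnerProductSpace ℂ K] [CompleteSpace K]
    {H : Type*} [NormedAddCommGroup H] [InnerProductSpace ℂ H] [CompleteSpace H]
    (N : Submodule ℂ (Op H)) : Prop :=
  ∃ A : VonNeumannAlgebra K, (∀ a ∈ A, ∀ b ∈ A, a * b = b * a) ∧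
    ∃ e : A.toStarSubalgebra ≃ₗᵢ[ℂ] N,
      (∀ a, (e (star a) : Op H) = star (e a : Op H)) ∧ (e 1 : Op H) = 1

end Contextuality

end

/-!
Operators in `N` are functions on a compact Hausdorff space: by Gelfand duality there is a unital
`*`-preserving linear isometry `ε` from `C(X)` onto `N` (`exists_continuousMap_equiv`). It need
be neither multiplicative nor normal as a map into the bounded operators on `H`, but it is an
order isomorphism onto `N`, because positivity in a C⋆-algebra can be read off from the norm
(`isPositive_of_nonneg`, `re_nonneg_of_accretive`).

The Riesz–Markov–Kakutani theorem represents `ε` by a measure `E` on `X` with values in the positive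
operators (`exists_effects`). As `X` is in general not standard Borel, `E` has to be replaced by a
coarser measure without losing any information about `ε`. Let `ρ₀` be a faithful state, let
`μ = tr(ρ₀ E)`, and let `vₙ` be a dense sequence in `H`. The densities `dₙ` of `⟪vₙ, E vₙ⟫` with
respect to `μ` combine to a map `d` from `X` to the standard Borel space `Ω` of sequences in
`[0, ∞]`, and `G` is the image of `E` under `d`. For `f` in `C(X)` the integral of `f` against `E`
agrees with the integral of the conditional expectation of `f` given `d`, which is a function on
`Ω`. Indeed, this holds for the vector functional of `vₙ`, since its density factors through `d`
(`integral_comp_smul_eq`), hence for all vector functionals by continuity (`continuous_integral`),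
and every state is a mixture of vector functionals (`State.exists_hasSum`). Therefore the map from
`N` to `L^∞(Ω)` that sends `ε f` to the conditional expectation of `f` reproduces all outcome
probabilities (`integral_response_eq_inner`).

It remains to extend this map, as a positive map, from `N` to all bounded operators
(`exists_response`). It induces the positive functional `F ↦ ∫ (ε⁻¹ F(d x))(x) dμ(x)` on the
`N`-valued simple functions on `Ω`. The theorem of M. Riesz extends this functional to a positive
one on all operator valued simple functions, and the value of the extended map at an operator `a` is
the density of the set function `Y ↦ (value of the extended functional at 1_Y a)`.
-/

namespace Contextuality

set_option linter.unusedSectionVars false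

/-! ### The trace and faithful states -/

section Trace

variable {H : Type*} [NormedAddCommGroup H] [InnerProductSpace ℂ H] [CompleteSpace H]
  {ι : Type*}

theorem hasSum_sq_norm_inner (b : HilbertBasis ι ℂ H) (x : H) :
    HasSum (fun i => ‖⟪b i, x⟫_ℂ‖ ^ 2) (‖x‖ ^ 2) := by
  have h := b.hasSum_inner_mul_inner x x
  rw [inner_self_eq_norm_sq_to_K] at h
  have h2 := Complex.hasSum_re h
  convert h2 using 1
  · ext i
    rw [← inner_conj_symm x (b i), RCLike.conj_mul]
    norm_cast
  · norm_cast

theorem exists_sqrt {A : Op H} (hA : A.IsPositive) :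
    ∃ s : Op H, (∀ x y, ⟪s x, y⟫_ℂ = ⟪x, s y⟫_ℂ) ∧ s * s = A := by
  refine ⟨CFC.sqrt A, fun x y => ?_,
    CFC.sqrt_mul_sqrt_self A ((ContinuousLinearMap.nonneg_iff_isPositive _).2 hA)⟩
  have := ContinuousLinearMap.adjoint_inner_left (CFC.sqrt A) y x
  rwa [← ContinuousLinearMap.star_eq_adjoint, (CFC.sqrt_nonneg A).isSelfAdjoint.star_eq] at this

theorem inner_mul_self_apply {s : Op H} (hs : ∀ x y, ⟪s x, y⟫_ℂ = ⟪x, s y⟫_ℂ) (x : H) :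
    ⟪x, (s * s) x⟫_ℂ = ((‖s x‖ ^ 2 : ℝ) : ℂ) := by
  rw [mul_apply_eq_comp, ← hs, inner_self_eq_norm_sq_to_K]
  norm_cast

theorem summable_sq_norm_inner_prod (e : HilbertBasis ι ℂ H) {v : ι → H}
    (hv : Summable fun i => ‖v i‖ ^ 2) :
    Summable fun p : ι × ι => ‖⟪e p.2, v p.1⟫_ℂ‖ ^ 2 := by
  rw [summable_prod_of_nonneg fun p => by positivity]
  refine ⟨fun j => (hasSum_sq_norm_inner e (v j)).summable, ?_⟩
  have h : ∀ j, ∑' i, ‖⟪e i, v j⟫_ℂ‖ ^ 2 = ‖v j‖ ^ 2 := fun j =>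
    (hasSum_sq_norm_inner e (v j)).tsum_eq
  simpa only [h] using hv

/-- Inserting the resolution of the identity twice gives an absolutely convergent double series,
as the vectors `s eᵢ` are square summable. -/
theorem summable_inner_mul_inner (e : HilbertBasis ι ℂ H) {s : Op H}
    (hu : Summable fun i => ‖s (e i)‖ ^ 2) (A : Op H) :
    Summable fun p : ι × ι => ⟪e p.2, s (e p.1)⟫_ℂ * ⟪s (e p.1), A (e p.2)⟫_ℂ := by
  let B : Op H := ContinuousLinearMap.adjoint A
  have hB : ∀ x y, ⟪x, A y⟫_ℂ = ⟪B x, y⟫_ℂ := fun x y =>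
    (ContinuousLinearMap.adjoint_inner_left A y x).symm
  have hu' : Summable fun i => ‖B (s (e i))‖ ^ 2 := by
    refine Summable.of_nonneg_of_le (fun _ => by positivity) (fun j => ?_)
      (hu.mul_left (‖B‖ ^ 2))
    rw [← mul_pow]
    gcongr
    exact B.le_opNorm _
  have hG := (summable_sq_norm_inner_prod e hu).add (summable_sq_norm_inner_prod e hu')
  refine Summable.of_norm_bounded hG fun p => ?_
  rw [norm_mul, hB, norm_inner_symm (B (s (e p.1))) (e p.2)]
  nlinarith [sq_nonneg (‖⟪e p.2, s (e p.1)⟫_ℂ‖ - ‖⟪e p.2, B (s (e p.1))⟫_ℂ‖),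
    sq_nonneg (‖⟪e p.2, s (e p.1)⟫_ℂ‖), sq_nonneg (‖⟪e p.2, B (s (e p.1))⟫_ℂ‖)]

/-- Cyclicity of the trace: `tr(s A s) = tr(s s A)` for a Hilbert–Schmidt operator `s`. -/
theorem hasSum_inner_sandwich (e : HilbertBasis ι ℂ H) {s : Op H}
    (hs : ∀ x y, ⟪s x, y⟫_ℂ = ⟪x, s y⟫_ℂ)
    (hu : Summable fun i => ‖s (e i)‖ ^ 2) (A : Op H) :
    HasSum (fun i => ⟪s (e i), A (s (e i))⟫_ℂ) (∑' i, ⟪e i, (s * s * A) (e i)⟫_ℂ) := by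
  have hF := summable_inner_mul_inner e hu A
  have hrow : ∀ j, HasSum (fun i => ⟪e i, s (e j)⟫_ℂ * ⟪s (e j), A (e i)⟫_ℂ)
      ⟪s (e j), A (s (e j))⟫_ℂ := fun j => by
    have h := e.hasSum_inner_mul_inner (ContinuousLinearMap.adjoint A (s (e j))) (s (e j))
    rw [ContinuousLinearMap.adjoint_inner_left] at h
    simp only [ContinuousLinearMap.adjoint_inner_left] at h
    simpa only [mul_comm] using h
  have hcol : ∀ i, HasSum (fun j => ⟪e i, s (e j)⟫_ℂ * ⟪s (e j), A (e i)⟫_ℂ)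
      ⟪e i, (s * s * A) (e i)⟫_ℂ := fun i => by
    have h := e.hasSum_inner_mul_inner (s (e i)) (s (A (e i)))
    rw [hs] at h
    simpa only [hs, mul_apply_eq_comp] using h
  have h1 := hF.hasSum.prod_fiberwise hrow
  have h2 := ((Equiv.prodComm ι ι).hasSum_iff.2 hF.hasSum).prod_fiberwise hcol
  rw [h2.tsum_eq]
  exact h1

/-- A state is a mixture of the vector functionals of the vectors `√ρ eᵢ`. -/
theorem State.exists_hasSum (ρ : State H) : ∃ u : basisIndex H → H,
    HasSum (fun i => ‖u i‖ ^ 2) 1 ∧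
    ∀ A : Op H, HasSum (fun i => ⟪u i, A (u i)⟫_ℂ) (trace (ρ.op * A)) := by
  obtain ⟨s, hs, hss⟩ := exists_sqrt ρ.pos
  have hu : HasSum (fun i => ‖s (onb H i)‖ ^ 2) 1 := by
    have htr := ρ.trace_eq_one
    rw [trace, ← hss] at htr
    simp only [inner_mul_self_apply hs] at htr
    rw [← Complex.ofReal_tsum, Complex.ofReal_eq_one] at htr
    have hsum : Summable (fun i => ‖s (onb H i)‖ ^ 2) := by
      -- otherwise the trace is `0` by convention
      by_contra hc
      rw [tsum_eq_zero_of_not_summable hc] at htr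
      exact zero_ne_one htr
    exact htr ▸ hsum.hasSum
  refine ⟨fun i => s (onb H i), hu, fun A => ?_⟩
  rw [trace, ← hss]
  exact hasSum_inner_sandwich (onb H) hs hu.summable A

theorem countable_of_hilbertBasis [TopologicalSpace.SeparableSpace H] (e : HilbertBasis ι ℂ H) :
    Countable ι := by
  have hd : (Set.univ : Set ι).PairwiseDisjoint (fun i => Metric.ball (e i) (1 / 2)) := by
    intro i _ j _ hij
    refine Metric.ball_disjoint_ball ?_
    have h : ‖e i - e j‖ ^ 2 = 2 := by
      have ho := e.orthonormal
      rw [@norm_sub_sq ℂ, ho.1 i, ho.1 j, ho.2 hij]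
      norm_num
    rw [dist_eq_norm]
    nlinarith [norm_nonneg (e i - e j)]
  have := hd.countable_of_isOpen (fun _ _ => Metric.isOpen_ball)
    (fun i _ => ⟨e i, Metric.mem_ball_self (by norm_num)⟩)
  exact Set.countable_univ_iff.1 this

theorem nonempty_of_hilbertBasis [Nontrivial H] (e : HilbertBasis ι ℂ H) : Nonempty ι := by
  by_contra hc
  rw [not_nonempty_iff] at hc
  obtain ⟨x, hx⟩ := exists_ne (0 : H)
  have h := (hasSum_sq_norm_inner e x).unique hasSum_empty
  simp_all

theorem exists_pos_hasSum_one [Countable ι] [Nonempty ι] :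
    ∃ w : ι → ℝ, (∀ i, 0 < w i) ∧ HasSum w 1 := by
  obtain ⟨w, hw0, c, hc, -⟩ := NNReal.exists_pos_sum_of_countable one_ne_zero ι
  have hc0 : 0 < c := by
    obtain ⟨i⟩ := ‹Nonempty ι›
    exact (hw0 i).trans_le (le_hasSum hc i fun _ _ => zero_le)
  refine ⟨fun i => w i / c, fun i => div_pos (hw0 i) hc0, ?_⟩
  have := (NNReal.hasSum_coe.2 hc).div_const (c : ℝ)
  rwa [div_self (by exact_mod_cast hc0.ne')] at this

/-- The diagonal operator with positive summable eigenvalues `w`. -/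
theorem exists_diagonal (e : HilbertBasis ι ℂ H) {w : ι → ℝ} (hw0 : ∀ i, 0 < w i)
    (hw : Summable w) : ∃ R : Op H, R.IsPositive ∧ ∀ i, R (e i) = (w i : ℂ) • e i := by
  let P : ι → Op H := fun i => (w i : ℂ) • InnerProductSpace.rankOne ℂ (e i) (e i)
  have hP : Summable P := by
    refine Summable.of_norm_bounded hw fun i => ?_
    have : ‖e i‖ = 1 := e.orthonormal.1 i
    simp [P, norm_smul, this, abs_of_pos (hw0 i)]
  have hPpos : ∀ i, 0 ≤ P i := fun i => by
    rw [ContinuousLinearMap.nonneg_iff_isPositive]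
    exact (InnerProductSpace.isPositive_rankOne_self _).smul_of_nonneg
      (by exact_mod_cast (hw0 i).le)
  refine ⟨∑' i, P i, ?_, fun j => ?_⟩
  · rw [← ContinuousLinearMap.nonneg_iff_isPositive]
    exact tsum_nonneg hPpos
  · have h1 : HasSum (fun i => P i (e j)) ((∑' i, P i) (e j)) :=
      hP.hasSum.mapL (ContinuousLinearMap.apply ℂ H (e j) : Op H →L[ℂ] H)
    refine h1.unique ?_
    have h2 : (w j : ℂ) • e j = P j (e j) := by
      have : ⟪e j, e j⟫_ℂ = 1 := by
        rw [inner_self_eq_norm_sq_to_K, e.orthonormal.1 j]; simp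
      simp only [P, smul_apply, InnerProductSpace.rankOne_apply, this, one_smul]
    rw [h2]
    refine hasSum_single j fun i hij => ?_
    simp [P, e.orthonormal.2 hij]

/-- A positive operator with vanishing weighted diagonal is zero. -/
theorem eq_zero_of_tsum_diagonal_eq_zero (e : HilbertBasis ι ℂ H) {w : ι → ℝ}
    (hw0 : ∀ i, 0 < w i) (hw : Summable w) {A : Op H} (hA : A.IsPositive)
    (h : ∑' i, (w i : ℂ) * ⟪e i, A (e i)⟫_ℂ = 0) : A = 0 := by
  obtain ⟨s, hs, rfl⟩ := exists_sqrt hA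
  simp only [inner_mul_self_apply hs, ← Complex.ofReal_mul] at h
  rw [← Complex.ofReal_tsum, Complex.ofReal_eq_zero] at h
  have hsum : Summable fun i => w i * ‖s (e i)‖ ^ 2 := by
    refine Summable.of_nonneg_of_le (fun i => mul_nonneg (hw0 i).le (by positivity)) (fun i => ?_)
      (hw.mul_right (‖s‖ ^ 2))
    have h1 := s.le_opNorm (e i)
    rw [e.orthonormal.1 i, mul_one] at h1
    have h2 := (hw0 i).le
    gcongr
  have hz := (hasSum_zero_iff_of_nonneg (fun i => mul_nonneg (hw0 i).le (by positivity))).1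
    (h ▸ hsum.hasSum)
  have hse : ∀ i, s (e i) = 0 := fun i => by
    have := congrFun hz i
    simpa [(hw0 i).ne'] using this
  have hs0 : s = 0 := by
    refine ContinuousLinearMap.ext_on (s := Set.range e) ?_ ?_
    · rw [Submodule.dense_iff_topologicalClosure_eq_top]
      exact e.dense_span
    · rintro _ ⟨i, rfl⟩
      simp [hse i]
  rw [hs0, mul_zero]

/-- On a separable space, a diagonal operator with strictly positive eigenvalues of sum one is a
faithful state. -/
theorem State.exists_faithful [TopologicalSpace.SeparableSpace H] [Nontrivial H] :
    ∃ ρ : State H, ρ.Faithful := by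
  have := countable_of_hilbertBasis (onb H)
  have := nonempty_of_hilbertBasis (onb H)
  obtain ⟨w, hw0, hw⟩ := exists_pos_hasSum_one (ι := basisIndex H)
  obtain ⟨R, hR, hRe⟩ := exists_diagonal (onb H) hw0 hw.summable
  have htr : ∀ A : Op H, trace (R * A) = ∑' i, (w i : ℂ) * ⟪onb H i, A (onb H i)⟫_ℂ := fun A => by
    refine tsum_congr fun i => ?_
    rw [mul_apply_eq_comp, ← hR.inner_left_eq_inner_right, hRe, inner_smul_left,
      Complex.conj_ofReal]
  refine ⟨⟨R, hR, ?_⟩, fun A hA h => ?_⟩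
  · have h1 : ∀ i, (w i : ℂ) * ⟪onb H i, (1 : Op H) (onb H i)⟫_ℂ = ((w i : ℝ) : ℂ) := fun i => by
      rw [one_apply_eq_self, inner_self_eq_norm_sq_to_K, (onb H).orthonormal.1 i]; simp
    have := htr 1
    rw [mul_one] at this
    simp only [this, h1]
    rw [← Complex.ofReal_tsum, hw.tsum_eq, Complex.ofReal_one]
  · rw [htr] at h
    exact eq_zero_of_tsum_diagonal_eq_zero (onb H) hw0 hw.summable hA h

end Trace

/-! ### Weak limits of contractions -/

section WeakLimit

variable {H : Type*} [NormedAddCommGroup H] [InnerProductSpace ℂ H] [CompleteSpace H]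

open Filter Topology in
/-- If the quadratic forms of a net of contractions converge pointwise, then the limit is the
quadratic form of a bounded operator. -/
theorem exists_op_of_tendsto_inner {ι : Type*} {l : Filter ι} [l.NeBot] {A : ι → Op H}
    (hA : ∀ i, ‖A i‖ ≤ 1) {q : H → ℝ}
    (hq : ∀ v, Tendsto (fun i => ⟪v, A i v⟫_ℂ) l (𝓝 (q v : ℂ))) :
    ∃ L : Op H, ∀ v, ⟪v, L v⟫_ℂ = q v := by
  have hq' : ∀ v, Tendsto (fun i => ⟪A i v, v⟫_ℂ) l (𝓝 (q v : ℂ)) := fun v => by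
    have := (Complex.continuous_conj.tendsto _).comp (hq v)
    rw [Complex.conj_ofReal] at this
    refine this.congr fun i => ?_
    exact inner_conj_symm _ _
  have hb : ∀ v w, ∃ c, Tendsto (fun i => ⟪A i v, w⟫_ℂ) l (𝓝 c) := fun v w => by
    refine ⟨_, Tendsto.congr (fun i => (inner_map_polarization (A i : H →ₗ[ℂ] H) w v).symm)
      ((((hq' (w + v)).sub (hq' (w - v))).add ((hq' (w + Complex.I • v)).const_mul Complex.I)).sub
        ((hq' (w - Complex.I • v)).const_mul Complex.I) |>.div_const 4)⟩
  choose b hb using hb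
  let B : H →ₗ⋆[ℂ] H →ₗ[ℂ] ℂ := LinearMap.mk₂'ₛₗ (starRingEnd ℂ) (RingHom.id ℂ) b
    (fun v v' w => tendsto_nhds_unique (hb _ _) (((hb v w).add (hb v' w)).congr fun i => by
      rw [map_add, inner_add_left]))
    (fun c v w => tendsto_nhds_unique (hb _ _) (((hb v w).const_smul (starRingEnd ℂ c)).congr
      fun i => by rw [map_smul, inner_smul_left, smul_eq_mul]))
    (fun v w w' => tendsto_nhds_unique (hb _ _) (((hb v w).add (hb v w')).congr fun i => by
      rw [inner_add_right]))
    (fun c v w => tendsto_nhds_unique (hb _ _) (((hb v w).const_smul c).congr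
      fun i => by rw [inner_smul_right, smul_eq_mul]))
  have hB : ∀ v w, ‖B v w‖ ≤ 1 * ‖v‖ * ‖w‖ := fun v w => by
    refine le_of_tendsto (hb v w).norm (Eventually.of_forall fun i => ?_)
    refine (norm_inner_le_norm _ _).trans ?_
    gcongr
    exact (A i).le_of_opNorm_le (hA i) v
  let B' : H →L⋆[ℂ] H →L[ℂ] ℂ := B.mkContinuous₂ 1 hB
  refine ⟨InnerProductSpace.continuousLinearMapOfBilin B', fun v => ?_⟩
  have h : ⟪InnerProductSpace.continuousLinearMapOfBilin B' v, v⟫_ℂ = q v := by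
    rw [InnerProductSpace.continuousLinearMapOfBilin_apply]
    exact tendsto_nhds_unique (hb v v) (hq' v)
  rw [← inner_conj_symm, h, Complex.conj_ofReal]

end WeakLimit

/-! ### Operator valued measures on compact spaces -/

section Compact

open scoped CompactlySupported

variable {X : Type*} [TopologicalSpace X] [CompactSpace X] [T2Space X] [MeasurableSpace X]
  [BorelSpace X]

/-- A measurable set is approximated, simultaneously for finitely many regular measures, by a
continuous function with values in `[0, 1]`. -/
theorem exists_continuous_integral_approx {ι : Type*} (S : Finset ι) (μ : ι → Measure X)
    [∀ i, IsFiniteMeasure (μ i)] [∀ i, (μ i).InnerRegular] {B : Set X} (hB : MeasurableSet B)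
    {ε : ℝ} (hε : 0 < ε) :
    ∃ f : C(X, ℝ), (∀ x, f x ∈ Set.Icc 0 1) ∧
      ∀ i ∈ S, |∫ x, f x ∂(μ i) - (μ i).real B| ≤ ε := by
  let m : Measure X := ∑ i ∈ S, μ i
  have hε' : ENNReal.ofReal ε ≠ 0 := by simpa using hε
  obtain ⟨F, hFB, hF, hmF⟩ := hB.exists_isClosed_sdiff_lt (μ := m) (measure_ne_top _ _) hε'
  obtain ⟨U, hBU, hU, -, hmU⟩ := hB.exists_isOpen_sdiff_lt (μ := m) (measure_ne_top _ _) hε'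
  obtain ⟨f, hf0, hf1, hf⟩ := exists_continuous_zero_one_of_isClosed hU.isClosed_compl hF
    (Set.disjoint_left.2 fun x hx hx' => hx (hBU (hFB hx')))
  refine ⟨f, hf, fun i hi => ?_⟩
  have hle : μ i ≤ m := Measure.le_iff.2 fun s _ => by
    rw [Measure.finsetSum_apply]
    exact Finset.single_le_sum (f := fun i => μ i s) (fun _ _ => zero_le) hi
  have hreal : ∀ Y : Set X, m Y < ENNReal.ofReal ε → (μ i).real Y ≤ ε := fun Y hY =>
    ENNReal.toReal_le_of_le_ofReal hε.le ((hle Y).trans hY.le)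
  have hint : Integrable f (μ i) := f.continuous.integrable_of_hasCompactSupport
    (HasCompactSupport.of_compactSpace _)
  have h1 : (μ i).real F ≤ ∫ x, f x ∂(μ i) := by
    rw [← integral_indicator_one hF.measurableSet]
    refine integral_mono ((integrable_const _).indicator hF.measurableSet) hint fun x => ?_
    by_cases hx : x ∈ F
    · simp [hx, hf1 hx]
    · simp [hx, (hf x).1]
  have h2 : ∫ x, f x ∂(μ i) ≤ (μ i).real U := by
    rw [← integral_indicator_one hU.measurableSet]
    refine integral_mono hint ((integrable_const _).indicator hU.measurableSet) fun x => ?_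
    by_cases hx : x ∈ U
    · simp [hx, (hf x).2]
    · simp [hx, hf0 hx]
  have h3 := hreal _ hmF
  have h4 := hreal _ hmU
  rw [measureReal_sdiff hFB hF.measurableSet] at h3
  rw [measureReal_sdiff hBU hB] at h4
  rw [abs_le]
  constructor <;> linarith

/-- The inclusion of the real continuous functions into the complex ones. -/
def realToComplex : C(X, ℝ) →ₗ[ℝ] C(X, ℂ) where
  toFun f := ⟨fun x => (f x : ℂ), by fun_prop⟩
  map_add' f g := by ext; simp
  map_smul' c f := by ext; simp

@[simp]
theorem realToComplex_apply (f : C(X, ℝ)) (x : X) : realToComplex f x = (f x : ℂ) := rfl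

variable {H : Type*} [NormedAddCommGroup H] [InnerProductSpace ℂ H] [CompleteSpace H]

/-- The Riesz–Markov–Kakutani theorem for the functional `f ↦ ⟪v, Φ f v⟫`. -/
theorem exists_measure_integral_eq_inner (Φ : C(X, ℂ) →ₗ[ℂ] Op H)
    (hΦ : ∀ f : C(X, ℂ), (∀ x, 0 ≤ f x) → (Φ f).IsPositive) (v : H) :
    ∃ μ : Measure X, IsFiniteMeasure μ ∧ μ.InnerRegular ∧
      ∀ f : C(X, ℂ), ∫ x, f x ∂μ = ⟪v, Φ f v⟫_ℂ := by
  let Λ₀ : C(X, ℝ) →ₗ[ℝ] ℝ :=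
    { toFun f := (⟪v, Φ (realToComplex f) v⟫_ℂ).re
      map_add' f g := by
        rw [map_add, map_add, add_apply, inner_add_right, Complex.add_re]
      map_smul' c f := by
        have h : realToComplex (c • f) = (c : ℂ) • realToComplex f := by ext; simp
        rw [h, map_smul, smul_apply, inner_smul_right, Complex.re_ofReal_mul]
        rfl }
  have hΛ₀ : ∀ f : C(X, ℝ), (∀ x, 0 ≤ f x) → (Λ₀ f : ℂ) = ⟪v, Φ (realToComplex f) v⟫_ℂ ∧
      0 ≤ Λ₀ f := fun f hf => by
    have h := (hΦ (realToComplex f) (fun x => by simpa using hf x)).inner_nonneg_right v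
    have := Complex.nonneg_iff.1 h
    exact ⟨Complex.ext rfl (by simpa using this.2), this.1⟩
  have hreal : ∀ f : C(X, ℝ), (Λ₀ f : ℂ) = ⟪v, Φ (realToComplex f) v⟫_ℂ := fun f => by
    have h1 := (hΛ₀ (f + ContinuousMap.const X ‖f‖) fun x => by
      have := neg_le_of_abs_le (f.norm_coe_le_norm x)
      simp only [ContinuousMap.add_apply, ContinuousMap.const_apply]
      linarith).1
    have h2 := (hΛ₀ (ContinuousMap.const X ‖f‖) fun x => norm_nonneg f).1
    rw [map_add, map_add, map_add, add_apply, inner_add_right, Complex.ofReal_add, h2] at h1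
    exact add_right_cancel h1
  let Λ : C_c(X, ℝ) →ₚ[ℝ] ℝ :=
    { toFun f := Λ₀ f.toContinuousMap
      map_add' f g := Λ₀.map_add _ _
      map_smul' c f := Λ₀.map_smul _ _
      monotone' f g hfg := by
        have := (hΛ₀ (g.toContinuousMap - f.toContinuousMap) fun x => sub_nonneg.2 (hfg x)).2
        rw [map_sub] at this
        exact sub_nonneg.1 this }
  refine ⟨RealRMK.rieszMeasure Λ, inferInstance, inferInstance, fun f => ?_⟩
  have hint : ∀ g : C(X, ℝ), ∫ x, g x ∂(RealRMK.rieszMeasure Λ) = Λ₀ g := fun g =>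
    RealRMK.integral_rieszMeasure Λ ⟨g, HasCompactSupport.of_compactSpace _⟩
  let fr : C(X, ℝ) := ⟨fun x => (f x).re, by fun_prop⟩
  let fi : C(X, ℝ) := ⟨fun x => (f x).im, by fun_prop⟩
  have hf : f = realToComplex fr + Complex.I • realToComplex fi := by
    ext x
    simp [fr, fi, mul_comm Complex.I, Complex.re_add_im]
  have hfint : Integrable f (RealRMK.rieszMeasure Λ) :=
    f.continuous.integrable_of_hasCompactSupport (HasCompactSupport.of_compactSpace _)
  rw [hf, map_add, add_apply, inner_add_right, map_smul, smul_apply, inner_smul_right,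
    ← hreal, ← hreal, ← hf, ← integral_re_add_im hfint, ← hint, ← hint, mul_comm Complex.I]
  rfl

/-- Positive unital maps from `C(X)` to the bounded operators are given by operator valued
measures, encoded by the measures `⟪v, E(·) v⟫`. -/
theorem exists_effects (Φ : C(X, ℂ) →ₗ[ℂ] Op H)
    (hΦ : ∀ f : C(X, ℂ), (∀ x, 0 ≤ f x) → (Φ f).IsPositive) (hΦ1 : Φ 1 = 1) :
    ∃ (m : H → Measure X) (E : Set X → Op H), (∀ v, m v Set.univ = ENNReal.ofReal (‖v‖ ^ 2)) ∧
      (∀ B, MeasurableSet B → ∀ v, ⟪v, E B v⟫_ℂ = (m v).real B) ∧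
      ∀ (f : C(X, ℂ)) v, ∫ x, f x ∂(m v) = ⟪v, Φ f v⟫_ℂ := by
  choose m hfin hreg hint using exists_measure_integral_eq_inner Φ hΦ
  classical
  have hE : ∀ B, MeasurableSet B → ∃ L : Op H, ∀ v, ⟪v, L v⟫_ℂ = (m v).real B := fun B hB => by
    have hf := fun α : Finset H × ℕ => exists_continuous_integral_approx α.1 m hB
      (Nat.one_div_pos_of_nat (α := ℝ) (n := α.2))
    choose f hf01 hf using hf
    have hΦf : ∀ α v, ⟪v, Φ (realToComplex (f α)) v⟫_ℂ = ((∫ x, f α x ∂(m v) : ℝ) : ℂ) :=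
      fun α v => by
        rw [← hint]
        exact integral_complex_ofReal
    refine exists_op_of_tendsto_inner (l := Filter.atTop)
      (A := fun α => Φ (realToComplex (f α))) (fun α => ?_) fun v => ?_
    · have h0 := hΦ (realToComplex (f α)) fun x => by simpa using (hf01 α x).1
      rw [CStarAlgebra.norm_le_one_iff_of_nonneg _
        ((ContinuousLinearMap.nonneg_iff_isPositive _).2 h0), ← hΦ1,
        ContinuousLinearMap.le_def, ← map_sub]
      refine hΦ _ fun x => ?_
      have : (0 : ℝ) ≤ 1 - f α x := sub_nonneg.2 (hf01 α x).2
      simpa using (by exact_mod_cast this : (0 : ℂ) ≤ ((1 - f α x : ℝ) : ℂ))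
    · simp only [hΦf]
      refine (Complex.continuous_ofReal.tendsto _).comp ?_
      rw [Metric.tendsto_atTop]
      intro ε hε
      obtain ⟨n, hn⟩ := exists_nat_one_div_lt hε
      refine ⟨({v}, n), fun α hα => ?_⟩
      rw [Real.dist_eq]
      refine (hf α v (hα.1 (Finset.mem_singleton_self v))).trans_lt (lt_of_le_of_lt ?_ hn)
      exact Nat.one_div_le_one_div hα.2
  choose! E hE using hE
  refine ⟨m, E, fun v => ?_, hE, fun f v => hint v f⟩
  have h := hint v 1
  rw [hΦ1, one_apply_eq_self, inner_self_eq_norm_sq_to_K] at h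
  simp only [ContinuousMap.one_apply, integral_const, Complex.real_smul, mul_one] at h
  rw [← ofReal_measureReal (measure_ne_top _ _)]
  congr 1
  exact Complex.ofReal_injective (h.trans (by norm_cast))

end Compact

/-! ### Outcome distributions -/

section QuadraticPOVM

variable {H : Type*} [NormedAddCommGroup H] [InnerProductSpace ℂ H] [CompleteSpace H]
  {Ω : Type*} [MeasurableSpace Ω]

/-- If the operators `E B` have the quadratic forms `v ↦ m v B`, then the distribution of `E` in
the state `ρ` is the sum of the measures `m (√ρ eᵢ)`. -/
theorem State.exists_sum_measure {m : H → Measure Ω} {E : Set Ω → Op H}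
    (hm : ∀ v, m v Set.univ = ENNReal.ofReal (‖v‖ ^ 2))
    (hE : ∀ B, MeasurableSet B → ∀ v, ⟪v, E B v⟫_ℂ = (m v).real B) (ρ : State H) :
    ∃ u : basisIndex H → H, IsProbabilityMeasure (Measure.sum fun i => m (u i)) ∧
      (∀ A : Op H, HasSum (fun i => ⟪u i, A (u i)⟫_ℂ) (trace (ρ.op * A))) ∧
      ∀ B, MeasurableSet B →
        trace (ρ.op * E B) = (((Measure.sum fun i => m (u i)).real B : ℝ) : ℂ) := by
  obtain ⟨u, hu, hA⟩ := ρ.exists_hasSum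
  have hfin : ∀ v, IsFiniteMeasure (m v) := fun v => ⟨by simp [hm]⟩
  refine ⟨u, ⟨?_⟩, hA, fun B hB => ?_⟩
  · rw [Measure.sum_apply _ MeasurableSet.univ]
    simp only [hm]
    rw [← ENNReal.ofReal_tsum_of_nonneg (fun _ => by positivity) hu.summable, hu.tsum_eq,
      ENNReal.ofReal_one]
  · have h := hA (E B)
    simp only [hE B hB] at h
    have hs : Summable fun i => (m (u i)).real B := Complex.summable_ofReal.1 h.summable
    rw [← h.tsum_eq, ← Complex.ofReal_tsum]
    congr 1
    rw [Measure.real, Measure.sum_apply _ hB, ENNReal.tsum_toReal_eq fun i => measure_ne_top _ _]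
    rfl

theorem POVM.measure_eq (G : POVM H Ω) (ρ : State H) {μ : Measure Ω} [IsFiniteMeasure μ]
    (h : ∀ B, MeasurableSet B → trace (ρ.op * G.effect B) = ((μ.real B : ℝ) : ℂ)) :
    G.measure ρ = μ := by
  have := G.isProbabilityMeasure_measure ρ
  ext B hB
  have h1 := (G.trace_mul_effect ρ hB).symm.trans (h B hB)
  rw [← ofReal_measureReal (measure_ne_top _ _), ← ofReal_measureReal (measure_ne_top _ _),
    Complex.ofReal_injective h1]

end QuadraticPOVM

/-! ### Densities of dominated set functions -/

section Density

variable {Ω : Type*} [MeasurableSpace Ω]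

open Filter Topology in
/-- A finitely additive set function dominated by a finite measure is countably additive. -/
theorem hasSum_of_dominated {ν : Measure Ω} [IsFiniteMeasure ν] {m : Set Ω → ℝ} {C : ℝ}
    (hadd : ∀ A B, MeasurableSet A → MeasurableSet B → Disjoint A B → m (A ∪ B) = m A + m B)
    (h0 : ∀ A, MeasurableSet A → 0 ≤ m A) (hC : ∀ A, MeasurableSet A → m A ≤ C * ν.real A)
    {f : ℕ → Set Ω} (hf : ∀ i, MeasurableSet (f i)) (hd : Pairwise (Function.onFun Disjoint f)) :
    HasSum (fun i => m (f i)) (m (⋃ i, f i)) := by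
  have hempty : m ∅ = 0 := by
    have := hadd ∅ ∅ MeasurableSet.empty MeasurableSet.empty (by simp)
    simpa using this
  let U : ℕ → Set Ω := fun n => ⋃ i ∈ Finset.range n, f i
  have hU : ∀ n, MeasurableSet (U n) := fun n => Finset.measurableSet_biUnion _ fun i _ => hf i
  have hsum : ∀ n, m (U n) = ∑ i ∈ Finset.range n, m (f i) := fun n => by
    induction n with
    | zero => simpa [U] using hempty
    | succ n ih =>
      have h1 : U (n + 1) = f n ∪ U n := by
        simp only [U, Finset.range_add_one, Finset.set_biUnion_insert]
      have h2 : Disjoint (f n) (U n) := by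
        simp only [U, Set.disjoint_iUnion_right]
        exact fun i hi => hd (Finset.mem_range.1 hi).ne'
      rw [h1, hadd _ _ (hf n) (hU n) h2, ih, Finset.sum_range_succ, add_comm]
  have hUm : MeasurableSet (⋃ i, f i) := MeasurableSet.iUnion hf
  have hsub : ∀ n, U n ⊆ ⋃ i, f i := fun n => Set.iUnion₂_subset fun i _ => Set.subset_iUnion f i
  have hsplit : ∀ n, m (⋃ i, f i) = m (U n) + m ((⋃ i, f i) \ U n) := fun n => by
    rw [← hadd _ _ (hU n) (hUm.diff (hU n)) Set.disjoint_sdiff_right,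
      Set.union_sdiff_cancel (hsub n)]
  rw [hasSum_iff_tendsto_nat_of_nonneg fun i => h0 _ (hf i)]
  simp only [← hsum]
  have hν : Tendsto (fun n => ν.real (U n)) atTop (𝓝 (ν.real (⋃ i, f i))) := by
    have h1 : Monotone U := fun n k hnk => Set.biUnion_subset_biUnion_left fun i hi =>
      Finset.mem_range.2 ((Finset.mem_range.1 hi).trans_le hnk)
    have h2 : ⋃ n, U n = ⋃ i, f i := by
      refine (Set.iUnion_subset hsub).antisymm (Set.iUnion_subset fun i => ?_)
      refine Set.subset_iUnion_of_subset (i + 1) ?_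
      exact Set.subset_biUnion_of_mem (u := f) (Finset.mem_coe.2 (Finset.self_mem_range_succ i))
    rw [← h2]
    exact (ENNReal.tendsto_toReal (measure_ne_top _ _)).comp (tendsto_measure_iUnion_atTop h1)
  have hrest : Tendsto (fun n => C * ν.real ((⋃ i, f i) \ U n)) atTop (𝓝 0) := by
    have h1 := ((tendsto_const_nhds (x := ν.real (⋃ i, f i))).sub hν).const_mul C
    rw [sub_self, mul_zero] at h1
    refine h1.congr fun n => ?_
    rw [measureReal_sdiff (hsub n) (hU n)]
  have hr0 : Tendsto (fun n => m ((⋃ i, f i) \ U n)) atTop (𝓝 0) :=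
    squeeze_zero (fun n => h0 _ (hUm.diff (hU n))) (fun n => hC _ (hUm.diff (hU n))) hrest
  have h2 := (tendsto_const_nhds (x := m (⋃ i, f i))).sub hr0
  rw [sub_zero] at h2
  exact h2.congr fun n => by rw [hsplit n, add_sub_cancel_right]

/-- A Radon–Nikodym theorem for finitely additive set functions between `0` and `C • ν`. The values
of `m` at non-measurable sets are irrelevant. -/
theorem exists_density {ν : Measure Ω} [IsFiniteMeasure ν] {m : Set Ω → ℝ} {C : ℝ}
    (hadd : ∀ A B, MeasurableSet A → MeasurableSet B → Disjoint A B → m (A ∪ B) = m A + m B)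
    (h0 : ∀ A, MeasurableSet A → 0 ≤ m A) (hC : ∀ A, MeasurableSet A → m A ≤ C * ν.real A) :
    ∃ h : Ω → ℝ, Measurable h ∧ (∀ x, 0 ≤ h x) ∧ (∀ᵐ x ∂ν, h x ≤ C) ∧
      ∀ A, MeasurableSet A → ∫ x in A, h x ∂ν = m A := by
  have hempty : m ∅ = 0 := by
    have := hadd ∅ ∅ MeasurableSet.empty MeasurableSet.empty (by simp)
    simpa using this
  let κ : Measure Ω := Measure.ofMeasurable (fun s _ => ENNReal.ofReal (m s)) (by simp [hempty])
    fun f hf hd => by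
      have h := hasSum_of_dominated hadd h0 hC hf hd
      rw [← h.tsum_eq, ENNReal.ofReal_tsum_of_nonneg (fun i => h0 _ (hf i)) h.summable]
  have hκ : ∀ A, MeasurableSet A → κ A = ENNReal.ofReal (m A) := fun A hA =>
    Measure.ofMeasurable_apply A hA
  have hκr : ∀ A, MeasurableSet A → κ.real A = m A := fun A hA => by
    rw [Measure.real, hκ A hA, ENNReal.toReal_ofReal (h0 A hA)]
  have hfin : IsFiniteMeasure κ := ⟨by rw [hκ _ MeasurableSet.univ]; exact ENNReal.ofReal_lt_top⟩
  have hac : κ ≪ ν := Measure.AbsolutelyContinuous.mk fun A hA hνA => by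
    rw [hκ A hA, ENNReal.ofReal_eq_zero]
    refine (hC A hA).trans ?_
    simp [Measure.real, hνA]
  have hint : ∀ A, MeasurableSet A → ∫ x in A, (κ.rnDeriv ν x).toReal ∂ν = m A := fun A hA => by
    rw [Measure.setIntegral_toReal_rnDeriv hac, hκr A hA]
  refine ⟨fun x => (κ.rnDeriv ν x).toReal, (Measure.measurable_rnDeriv κ ν).ennreal_toReal,
    fun x => ENNReal.toReal_nonneg, ?_, hint⟩
  refine ae_le_of_forall_setIntegral_le Measure.integrable_toReal_rnDeriv (integrable_const C)
    fun A hA _ => ?_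
  rw [hint A hA, setIntegral_const, smul_eq_mul, mul_comm]
  exact hC A hA

end Density

/-! ### Extension of positive functionals -/

section Extension

variable {H : Type*} [NormedAddCommGroup H] [InnerProductSpace ℂ H] [CompleteSpace H]
  {Ω : Type*} [MeasurableSpace Ω]

open Classical in
/-- The operator valued simple function `1_Y • a`, as a linear function of `a`. -/
noncomputable def indicatorOp (Y : Set Ω) (hY : MeasurableSet Y) :
    Op H →ₗ[ℂ] SimpleFunc Ω (Op H) where
  toFun a := SimpleFunc.piecewise Y hY (SimpleFunc.const Ω a) 0
  map_add' a b := by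
    ext1 x
    by_cases hx : x ∈ Y <;> simp [hx]
  map_smul' c a := by
    ext1 x
    by_cases hx : x ∈ Y <;> simp [hx]

theorem indicatorOp_apply (Y : Set Ω) (hY : MeasurableSet Y) (a : Op H) (x : Ω) :
    indicatorOp Y hY a x = Y.indicator (fun _ => a) x := by
  classical
  by_cases hx : x ∈ Y <;> simp [indicatorOp, hx]

theorem indicatorOp_union {Y Z : Set Ω} (hY : MeasurableSet Y) (hZ : MeasurableSet Z)
    (hd : Disjoint Y Z) (a : Op H) :
    indicatorOp (Y ∪ Z) (hY.union hZ) a = indicatorOp Y hY a + indicatorOp Z hZ a := by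
  ext1 x
  rw [SimpleFunc.coe_add, Pi.add_apply, indicatorOp_apply, indicatorOp_apply, indicatorOp_apply,
    Set.indicator_union_of_disjoint hd]

/-- The cone of operator valued simple functions with accretive values. It contains the positive
functions, and it contains both `F` and `-F` when the values of `F` are skew-adjoint. Its use in
place of the positive cone makes the extension theorem applicable to non-self-adjoint
operators. -/
def accretiveCone (Ω H : Type*) [MeasurableSpace Ω] [NormedAddCommGroup H]
    [InnerProductSpace ℂ H] : PointedCone ℝ (SimpleFunc Ω (Op H)) where
  carrier := {F | ∀ x v, 0 ≤ (⟪v, F x v⟫_ℂ).re}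
  add_mem' {F G} hF hG x v := by
    rw [SimpleFunc.coe_add, Pi.add_apply, add_apply, inner_add_right, Complex.add_re]
    exact add_nonneg (hF x v) (hG x v)
  zero_mem' x v := by simp
  smul_mem' c F hF x v := by
    have h : ((c • F) x) v = ((c : ℝ) : ℂ) • F x v := rfl
    rw [h, inner_smul_right, Complex.re_ofReal_mul]
    exact mul_nonneg c.2 (hF x v)

theorem indicatorOp_mem_accretiveCone {Y : Set Ω} (hY : MeasurableSet Y) {a : Op H}
    (ha : ∀ v, 0 ≤ (⟪v, a v⟫_ℂ).re) : indicatorOp Y hY a ∈ accretiveCone Ω H := by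
  intro x v
  rw [indicatorOp_apply]
  by_cases hx : x ∈ Y
  · simpa [hx] using ha v
  · simp [hx]

theorem re_inner_apply_le (a : Op H) (v : H) : (⟪v, a v⟫_ℂ).re ≤ ‖a‖ * ‖v‖ ^ 2 := by
  refine (Complex.re_le_norm _).trans ((norm_inner_le_norm _ _).trans ?_)
  have := a.le_opNorm v
  nlinarith [norm_nonneg v]

theorem re_inner_smul_one_sub (a : Op H) (r : ℝ) (v : H) :
    (⟪v, ((r : ℂ) • (1 : Op H) - a) v⟫_ℂ).re = r * ‖v‖ ^ 2 - (⟪v, a v⟫_ℂ).re := by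
  have h : ⟪v, v⟫_ℂ = ((‖v‖ ^ 2 : ℝ) : ℂ) := by rw [inner_self_eq_norm_sq_to_K]; norm_cast
  rw [sub_apply, smul_apply, one_apply_eq_self, inner_sub_right, inner_smul_right, h,
    Complex.sub_re, ← Complex.ofReal_mul, Complex.ofReal_re]

/-- Extension of a positive functional from the `N`-valued to all operator valued simple functions.
The constant multiples of the identity, which are `N`-valued, dominate every simple function. -/
theorem exists_accretive_extension (N : Submodule ℂ (Op H)) (h1 : 1 ∈ N)
    (ℓ : SimpleFunc Ω (Op H) →ₗ[ℝ] ℝ)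
    (hℓ : ∀ F ∈ accretiveCone Ω H, (∀ x, F x ∈ N) → 0 ≤ ℓ F) :
    ∃ g : SimpleFunc Ω (Op H) →ₗ[ℝ] ℝ, (∀ F : SimpleFunc Ω (Op H), (∀ x, F x ∈ N) → g F = ℓ F) ∧
      ∀ F ∈ accretiveCone Ω H, 0 ≤ g F := by
  let D : Submodule ℝ (SimpleFunc Ω (Op H)) :=
    { carrier := {F | ∀ x, F x ∈ N}
      add_mem' := fun hF hG x => N.add_mem (hF x) (hG x)
      zero_mem' := fun x => N.zero_mem
      smul_mem' := fun c F hF x => N.smul_mem (c : ℂ) (hF x) }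
  let f : SimpleFunc Ω (Op H) →ₗ.[ℝ] ℝ := ⟨D, ℓ.comp D.subtype⟩
  obtain ⟨g, hg, hpos⟩ := riesz_extension (accretiveCone Ω H) f (fun F hF => hℓ F hF F.2) fun F => by
    obtain ⟨r, hr⟩ : ∃ r : ℝ, ∀ x, ‖F x‖ ≤ r := by
      obtain ⟨r, hr⟩ := (F.finite_range.image norm).bddAbove
      exact ⟨r, fun x => hr ⟨_, ⟨x, rfl⟩, rfl⟩⟩
    refine ⟨⟨SimpleFunc.const Ω ((r : ℂ) • (1 : Op H)), fun x => N.smul_mem _ h1⟩, fun x v => ?_⟩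
    have h2 : (SimpleFunc.const Ω ((r : ℂ) • (1 : Op H)) + F) x
        = (r : ℂ) • (1 : Op H) - (-F x) := by simp
    change 0 ≤ (⟪v, ((SimpleFunc.const Ω ((r : ℂ) • (1 : Op H)) + F) x) v⟫_ℂ).re
    rw [h2, re_inner_smul_one_sub, sub_nonneg]
    refine (re_inner_apply_le _ v).trans ?_
    rw [norm_neg]
    gcongr
    exact hr x
  exact ⟨g, fun F hF => hg ⟨F, hF⟩, hpos⟩

end Extension

/-! ### Extension of positive maps into `L^∞` -/

section Response

variable {H : Type*} [NormedAddCommGroup H] [InnerProductSpace ℂ H] [CompleteSpace H]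
  {Ω : Type*} [MeasurableSpace Ω]

theorem integrable_Lp_top {ν : Measure Ω} [IsFiniteMeasure ν] (h : Lp ℂ ⊤ ν) : Integrable h ν :=
  (Lp.memLp h).integrable le_top

theorem Lp_top_ae_norm_le {ν : Measure Ω} (h : Lp ℂ ⊤ ν) : ∀ᵐ x ∂ν, ‖h x‖ ≤ ‖h‖ := by
  have h1 : ∀ᵐ x ∂ν, ‖h x‖ₑ ≤ eLpNorm h ⊤ ν := by
    rw [eLpNorm_exponent_top]
    exact ae_le_eLpNormEssSup
  filter_upwards [h1] with x hx
  rw [Lp.norm_def, ← toReal_enorm]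
  exact ENNReal.toReal_mono (Lp.eLpNorm_ne_top h) hx

theorem Lp_top_ext {ν : Measure Ω} [IsFiniteMeasure ν] {h k : Lp ℂ ⊤ ν}
    (hhk : ∀ Y : Set Ω, MeasurableSet Y → ∫ x in Y, h x ∂ν = ∫ x in Y, k x ∂ν) : h = k :=
  Lp.ext (Integrable.ae_eq_of_forall_setIntegral_eq _ _ (integrable_Lp_top h) (integrable_Lp_top k)
    fun Y hY _ => hhk Y hY)

/-- An `L^∞`-valued form of the Hahn–Banach extension theorem. A positive unital map from the
operator space `N` to `L^∞(ν)` is given through the positive functional `F ↦ ℓ F` that it induces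
on the `N`-valued simple functions; the densities of a positive extension of this functional give
the extension of the map to all operators. -/
theorem exists_response {ν : Measure Ω} [IsProbabilityMeasure ν] (N : Submodule ℂ (Op H))
    (h1 : 1 ∈ N) (ℓ : SimpleFunc Ω (Op H) →ₗ[ℝ] ℝ)
    (hℓ : ∀ F ∈ accretiveCone Ω H, (∀ x, F x ∈ N) → 0 ≤ ℓ F)
    (hν : ∀ (Y : Set Ω) (hY : MeasurableSet Y), ℓ (indicatorOp Y hY 1) = ν.real Y) :
    ∃ T : Op H →ₗ[ℂ] Lp ℂ ⊤ ν, (∀ A : Op H, A.IsPositive → ∀ᵐ x ∂ν, 0 ≤ T A x) ∧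
      (∀ᵐ x ∂ν, T 1 x = 1) ∧
      ∀ a ∈ N, ∀ (Y : Set Ω) (hY : MeasurableSet Y),
        (∫ x in Y, T a x ∂ν).re = ℓ (indicatorOp Y hY a) := by
  obtain ⟨g, hgN, hg⟩ := exists_accretive_extension N h1 ℓ hℓ
  have hindN : ∀ (Y : Set Ω) (hY : MeasurableSet Y), ∀ a ∈ N, ∀ x, indicatorOp Y hY a x ∈ N :=
    fun Y hY a ha x => by
      rw [indicatorOp_apply]
      by_cases hx : x ∈ Y <;> simp [hx, ha]
  -- the complexification of `a ↦ g (1_Y a)`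
  let τ : ∀ Y : Set Ω, MeasurableSet Y → Op H →ₗ[ℂ] ℂ := fun Y hY =>
    Module.Dual.extendRCLike (g.comp ((indicatorOp Y hY).restrictScalars ℝ))
  have hτ : ∀ (Y : Set Ω) (hY : MeasurableSet Y) a, τ Y hY a
      = (g (indicatorOp Y hY a) : ℂ) - Complex.I * g (indicatorOp Y hY (Complex.I • a)) :=
    fun Y hY a => rfl
  have hτre : ∀ (Y : Set Ω) (hY : MeasurableSet Y) a,
      (τ Y hY a).re = g (indicatorOp Y hY a) := fun Y hY a => by
    rw [hτ]; simp
  have hτpos : ∀ (Y : Set Ω) (hY : MeasurableSet Y), ∀ a : Op H, 0 ≤ a →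
      τ Y hY a = g (indicatorOp Y hY a) := fun Y hY a ha => by
    have ha' := (ContinuousLinearMap.nonneg_iff_isPositive _).1 ha
    have him : ∀ v, (⟪v, (Complex.I • a) v⟫_ℂ).re = 0 := fun v => by
      have := (Complex.nonneg_iff.1 (ha'.inner_nonneg_right v)).2
      rw [smul_apply, inner_smul_right, Complex.I_mul_re, ← this, neg_zero]
    have h2 := hg _ (indicatorOp_mem_accretiveCone hY (a := Complex.I • a) fun v => (him v).ge)
    have h3 := hg _ (indicatorOp_mem_accretiveCone hY (a := -(Complex.I • a)) fun v => by
      rw [neg_apply, inner_neg_right, Complex.neg_re, him v, neg_zero])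
    rw [map_neg, map_neg, Left.nonneg_neg_iff] at h3
    rw [hτ, le_antisymm h3 h2]
    simp
  have hex0 : ∀ a : Op H, 0 ≤ a → ∃ h : Lp ℂ ⊤ ν, (∀ᵐ x ∂ν, 0 ≤ h x) ∧
      ∀ (Y : Set Ω) (hY : MeasurableSet Y), ∫ x in Y, h x ∂ν = τ Y hY a := fun a ha => by
    classical
    have ha' := (ContinuousLinearMap.nonneg_iff_isPositive _).1 ha
    have hm : ∀ (Y : Set Ω) (hY : MeasurableSet Y),
        (if h : MeasurableSet Y then g (indicatorOp Y h a) else 0) = g (indicatorOp Y hY a) :=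
      fun Y hY => dif_pos hY
    obtain ⟨h, hh, hh0, hhC, hint⟩ := exists_density (ν := ν) (C := ‖a‖)
      (m := fun Y => if h : MeasurableSet Y then g (indicatorOp Y h a) else 0)
      (fun Y Z hY hZ hd => by
        simp only [hm _ hY, hm _ hZ, hm _ (hY.union hZ)]
        rw [indicatorOp_union hY hZ hd, map_add])
      (fun Y hY => by
        simp only [hm _ hY]
        exact hg _ (indicatorOp_mem_accretiveCone hY fun v => ha'.re_inner_nonneg_right v))
      (fun Y hY => by
        simp only [hm _ hY]
        have h2 := hg _ (indicatorOp_mem_accretiveCone hY (a := (‖a‖ : ℂ) • (1 : Op H) - a)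
          fun v => by
            rw [re_inner_smul_one_sub, sub_nonneg]
            exact re_inner_apply_le a v)
        have h3 : indicatorOp Y hY ((‖a‖ : ℂ) • (1 : Op H)) = ‖a‖ • indicatorOp Y hY (1 : Op H) := by
          rw [map_smul]; rfl
        rw [map_sub, h3, map_sub, map_smul, hgN _ (hindN Y hY 1 h1), hν, smul_eq_mul] at h2
        exact sub_nonneg.1 h2)
    have hmem : MemLp (fun x => (h x : ℂ)) ⊤ ν :=
      memLp_top_of_bound (Complex.measurable_ofReal.comp hh).aestronglyMeasurable ‖a‖ (by
        filter_upwards [hhC] with x hx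
        rw [Complex.norm_real, Real.norm_of_nonneg (hh0 x)]
        exact hx)
    refine ⟨hmem.toLp _, ?_, fun Y hY => ?_⟩
    · filter_upwards [hmem.coeFn_toLp] with x hx
      rw [hx]
      exact_mod_cast hh0 x
    · rw [setIntegral_congr_ae hY (hmem.coeFn_toLp.mono fun x hx _ => hx), hτpos Y hY a ha, ← hm,
        ← hint Y hY]
      exact integral_complex_ofReal
  have hex : ∀ a : Op H, ∃ h : Lp ℂ ⊤ ν, ∀ (Y : Set Ω) (hY : MeasurableSet Y),
      ∫ x in Y, h x ∂ν = τ Y hY a := fun a => by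
    have ha : a ∈ Submodule.span ℂ {b : Op H | 0 ≤ b} := by
      rw [CStarAlgebra.span_nonneg]; trivial
    induction ha using Submodule.span_induction with
    | mem b hb =>
      obtain ⟨h, -, hh⟩ := hex0 b hb
      exact ⟨h, hh⟩
    | zero =>
      refine ⟨0, fun Y hY => ?_⟩
      rw [setIntegral_congr_ae hY ((Lp.coeFn_zero ℂ ⊤ ν).mono fun x hx _ => hx)]
      simp
    | add b c _ _ hb hc =>
      obtain ⟨h, hh⟩ := hb
      obtain ⟨k, hk⟩ := hc
      refine ⟨h + k, fun Y hY => ?_⟩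
      rw [setIntegral_congr_ae hY ((Lp.coeFn_add h k).mono fun x hx _ => hx), map_add,
        ← hh Y hY, ← hk Y hY]
      exact integral_add (integrable_Lp_top h).integrableOn (integrable_Lp_top k).integrableOn
    | smul c b _ hb =>
      obtain ⟨h, hh⟩ := hb
      refine ⟨c • h, fun Y hY => ?_⟩
      rw [setIntegral_congr_ae hY ((Lp.coeFn_smul c h).mono fun x hx _ => hx), map_smul,
        ← hh Y hY]
      exact integral_const_mul c _
  choose T hT using hex
  let T' : Op H →ₗ[ℂ] Lp ℂ ⊤ ν :=
    { toFun := T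
      map_add' a b := Lp_top_ext fun Y hY => by
        rw [setIntegral_congr_ae hY ((Lp.coeFn_add (T a) (T b)).mono fun x hx _ => hx), hT _ Y hY,
          map_add, ← hT a Y hY, ← hT b Y hY]
        exact (integral_add (integrable_Lp_top _).integrableOn
          (integrable_Lp_top _).integrableOn).symm
      map_smul' c a := Lp_top_ext fun Y hY => by
        rw [RingHom.id_apply, setIntegral_congr_ae hY ((Lp.coeFn_smul c (T a)).mono fun x hx _ => hx),
          hT _ Y hY, map_smul, ← hT a Y hY]
        exact (integral_const_mul c _).symm }
  refine ⟨T', fun A hA => ?_, ?_, fun a ha Y hY => ?_⟩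
  · obtain ⟨h, hh0, hh⟩ := hex0 A ((ContinuousLinearMap.nonneg_iff_isPositive _).2 hA)
    have : T' A = h := Lp_top_ext fun Y hY => (hT A Y hY).trans (hh Y hY).symm
    rwa [this]
  · refine Integrable.ae_eq_of_forall_setIntegral_eq _ (fun _ => (1 : ℂ)) (integrable_Lp_top _)
      (integrable_const _) fun Y hY _ => ?_
    refine (hT 1 Y hY).trans ?_
    rw [hτpos Y hY 1 zero_le_one, hgN _ (hindN Y hY 1 h1), hν]
    simp
  · rw [← hgN _ (hindN Y hY a ha), ← hτre]
    exact congrArg Complex.re (hT a Y hY)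

end Response

/-! ### Continuity of the vector measures -/

section Continuity

variable {H : Type*} [NormedAddCommGroup H] [InnerProductSpace ℂ H] [CompleteSpace H]
  {Ω : Type*} [MeasurableSpace Ω]

/-- The Cauchy–Schwarz inequality for a positive form, split with a weight `δ`. -/
theorem re_inner_add_le {A : Op H} (hA : ∀ v, 0 ≤ (⟪v, A v⟫_ℂ).re) {δ : ℝ} (hδ : 0 < δ) (x y : H) :
    (⟪x + y, A (x + y)⟫_ℂ).re ≤ (1 + δ) * (⟪x, A x⟫_ℂ).re + (1 + δ⁻¹) * (⟪y, A y⟫_ℂ).re := by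
  have h := hA ((δ : ℂ) • x - y)
  simp only [map_add, map_sub, map_smul, inner_add_left, inner_add_right, inner_sub_left,
    inner_sub_right, inner_smul_left, inner_smul_right, Complex.conj_ofReal, Complex.add_re,
    Complex.sub_re, Complex.re_ofReal_mul] at h ⊢
  have h2 : (⟪x, A y⟫_ℂ).re + (⟪y, A x⟫_ℂ).re ≤ δ * (⟪x, A x⟫_ℂ).re + δ⁻¹ * (⟪y, A y⟫_ℂ).re := by
    rw [← mul_le_mul_iff_right₀ hδ]
    have : δ * (δ * (⟪x, A x⟫_ℂ).re + δ⁻¹ * (⟪y, A y⟫_ℂ).re)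
        = δ * (δ * (⟪x, A x⟫_ℂ).re) + (⟪y, A y⟫_ℂ).re := by field_simp
    rw [this]
    linarith
  linarith

/-- Integrals of a bounded nonnegative function against `m v` depend continuously on `v`, because
`m (v + w) ≤ (1 + δ) • m v + (1 + δ⁻¹) • m w` for all `δ > 0`. -/
theorem continuous_integral_of_nonneg {m : H → Measure Ω} {E : Set Ω → Op H}
    (hm : ∀ v, m v Set.univ = ENNReal.ofReal (‖v‖ ^ 2))
    (hE : ∀ B, MeasurableSet B → ∀ v, ⟪v, E B v⟫_ℂ = (m v).real B) {f : Ω → ℝ} {C : ℝ}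
    (hf : ∀ v, AEStronglyMeasurable f (m v)) (hf0 : ∀ v, ∀ᵐ x ∂(m v), 0 ≤ f x)
    (hfC : ∀ v, ∀ᵐ x ∂(m v), f x ≤ C) : Continuous fun v => ∫ x, f x ∂(m v) := by
  have hfin : ∀ v, IsFiniteMeasure (m v) := fun v => ⟨by simp [hm]⟩
  have hint : ∀ v, Integrable f (m v) := fun v => Integrable.of_bound (hf v) C (by
    filter_upwards [hf0 v, hfC v] with x h0 hC
    rwa [Real.norm_of_nonneg h0])
  let q : H → ℝ := fun v => ∫ x, f x ∂(m v)
  have hmr : ∀ v, (m v).real Set.univ = ‖v‖ ^ 2 := fun v => by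
    rw [Measure.real, hm, ENNReal.toReal_ofReal (by positivity)]
  have hqC : ∀ v, q v ≤ C * ‖v‖ ^ 2 := fun v => by
    have := integral_mono_ae (hint v) (integrable_const C) (hfC v)
    rwa [integral_const, hmr, smul_eq_mul, mul_comm] at this
  have hC0 : ∀ v : H, 0 ≤ C * ‖v‖ ^ 2 := fun v =>
    (integral_nonneg_of_ae (hf0 v)).trans (hqC v)
  have hq : ∀ v w, ∀ δ > 0, q (v + w) ≤ (1 + δ) * q v + (1 + δ⁻¹) * q w := fun v w δ hδ => by
    have hle : m (v + w) ≤ ENNReal.ofReal (1 + δ) • m v + ENNReal.ofReal (1 + δ⁻¹) • m w := by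
      refine Measure.le_iff.2 fun B hB => ?_
      have h1 := re_inner_add_le (A := E B) (fun v => by rw [hE B hB]; exact measureReal_nonneg)
        hδ v w
      simp only [hE B hB, Complex.ofReal_re] at h1
      simp only [Measure.coe_add, Measure.coe_smul, Pi.add_apply, Pi.smul_apply, smul_eq_mul]
      rw [← ofReal_measureReal (measure_ne_top (m v) B),
        ← ofReal_measureReal (measure_ne_top (m w) B),
        ← ofReal_measureReal (measure_ne_top (m (v + w)) B), ← ENNReal.ofReal_mul (by positivity),
        ← ENNReal.ofReal_mul (by positivity), ← ENNReal.ofReal_add (by positivity) (by positivity)]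
      exact ENNReal.ofReal_le_ofReal h1
    have hi1 : Integrable f (ENNReal.ofReal (1 + δ) • m v) :=
      (hint v).smul_measure ENNReal.ofReal_ne_top
    have hi2 : Integrable f (ENNReal.ofReal (1 + δ⁻¹) • m w) :=
      (hint w).smul_measure ENNReal.ofReal_ne_top
    have h2 := integral_mono_measure hle (ae_add_measure_iff.2
      ⟨Measure.ae_smul_measure (hf0 v) _, Measure.ae_smul_measure (hf0 w) _⟩) (hi1.add_measure hi2)
    rwa [integral_add_measure hi1 hi2, integral_smul_measure, integral_smul_measure,
      ENNReal.toReal_ofReal (by positivity), ENNReal.toReal_ofReal (by positivity)] at h2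
  have hdiff : ∀ v w, q v - q w ≤ ‖v - w‖ * (C * ‖w‖ ^ 2) + (C * ‖v - w‖ ^ 2 + ‖v - w‖ * C) :=
    fun v w => by
      rcases eq_or_ne v w with rfl | hne
      · simp
      · have hδ : 0 < ‖v - w‖ := norm_pos_iff.2 (sub_ne_zero.2 hne)
        have h1 := hq w (v - w) _ hδ
        rw [add_sub_cancel] at h1
        have h2 : (1 + ‖v - w‖⁻¹) * q (v - w) ≤ (1 + ‖v - w‖⁻¹) * (C * ‖v - w‖ ^ 2) := by
          gcongr
          exact hqC _
        have h3 : (1 + ‖v - w‖⁻¹) * (C * ‖v - w‖ ^ 2) = C * ‖v - w‖ ^ 2 + ‖v - w‖ * C := by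
          field_simp
        have h4 : ‖v - w‖ * q w ≤ ‖v - w‖ * (C * ‖w‖ ^ 2) := by
          gcongr
          exact hqC _
        linarith
  rw [continuous_iff_continuousAt]
  intro w
  rw [ContinuousAt, tendsto_iff_dist_tendsto_zero]
  let b : H → ℝ := fun v =>
    ‖v - w‖ * (C * ‖w‖ ^ 2 + C * ‖v‖ ^ 2) + (C * ‖v - w‖ ^ 2 + ‖v - w‖ * C)
  have hb : Filter.Tendsto b (nhds w) (nhds 0) := by
    have : Continuous b := by fun_prop
    simpa [b] using this.tendsto w
  refine squeeze_zero (fun _ => dist_nonneg) (fun v => ?_) hb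
  rw [Real.dist_eq]
  refine abs_sub_le_iff.2 ⟨(hdiff v w).trans ?_, (hdiff w v).trans ?_⟩
  · have := mul_nonneg (norm_nonneg (v - w)) (hC0 v)
    simp only [b]
    linarith
  · have := mul_nonneg (norm_nonneg (v - w)) (hC0 w)
    rw [norm_sub_rev w v]
    simp only [b]
    linarith

/-- Integrals of bounded functions against `m v` are continuous in `v`. -/
theorem continuous_integral {m : H → Measure Ω} {E : Set Ω → Op H}
    (hm : ∀ v, m v Set.univ = ENNReal.ofReal (‖v‖ ^ 2))
    (hE : ∀ B, MeasurableSet B → ∀ v, ⟪v, E B v⟫_ℂ = (m v).real B) {f : Ω → ℂ} {C : ℝ}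
    (hf : StronglyMeasurable f) (hfC : ∀ v, ∀ᵐ x ∂(m v), ‖f x‖ ≤ C) :
    Continuous fun v => ∫ x, f x ∂(m v) := by
  have hfin : ∀ v, IsFiniteMeasure (m v) := fun v => ⟨by simp [hm]⟩
  have hmr : ∀ v, (m v).real Set.univ = ‖v‖ ^ 2 := fun v => by
    rw [Measure.real, hm, ENNReal.toReal_ofReal (by positivity)]
  have hreal : ∀ g : Ω → ℝ, StronglyMeasurable g → (∀ v, ∀ᵐ x ∂(m v), |g x| ≤ C) →
      Continuous fun v => ∫ x, g x ∂(m v) := fun g hg hgC => by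
    have h1 := continuous_integral_of_nonneg hm hE (f := fun x => g x + C) (C := C + C)
      (fun v => (hg.add stronglyMeasurable_const).aestronglyMeasurable)
      (fun v => (hgC v).mono fun x hx => by linarith [(abs_le.1 hx).1])
      (fun v => (hgC v).mono fun x hx => by linarith [(abs_le.1 hx).2])
    have h2 : ∀ v, ∫ x, g x ∂(m v) = (∫ x, (g x + C) ∂(m v)) - ‖v‖ ^ 2 * C := fun v => by
      have hi : Integrable g (m v) := Integrable.of_bound hg.aestronglyMeasurable C (hgC v)
      rw [integral_add hi (integrable_const C), integral_const, hmr, smul_eq_mul,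
        add_sub_cancel_right]
    simp only [h2]
    fun_prop
  have h1 := hreal _ (RCLike.continuous_re.comp_stronglyMeasurable hf) fun v =>
    (hfC v).mono fun x hx => (Complex.abs_re_le_norm _).trans hx
  have h2 := hreal _ (RCLike.continuous_im.comp_stronglyMeasurable hf) fun v =>
    (hfC v).mono fun x hx => (Complex.abs_im_le_norm _).trans hx
  have h3 : ∀ v, ∫ x, f x ∂(m v)
      = ((∫ x, RCLike.re (f x) ∂(m v) : ℝ) : ℂ) + ((∫ x, RCLike.im (f x) ∂(m v) : ℝ) : ℂ) * Complex.I :=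
    fun v => (integral_re_add_im (Integrable.of_bound hf.aestronglyMeasurable C (hfC v))).symm
  simp only [h3]
  fun_prop

end Continuity

/-! ### Conditional expectations -/

section PullOut

variable {X Ω : Type*} [MeasurableSpace X] [MeasurableSpace Ω]

/-- Integrals against densities that factor through `d` only depend on the conditional expectation
given `d`. -/
theorem integral_comp_smul_eq {μ : Measure X} [IsFiniteMeasure μ] {d : X → Ω} (hd : Measurable d)
    {F G : X → ℂ} {C : ℝ} (hF : AEStronglyMeasurable F μ) (hFC : ∀ᵐ x ∂μ, ‖F x‖ ≤ C)
    (hG : AEStronglyMeasurable G μ) (hGC : ∀ᵐ x ∂μ, ‖G x‖ ≤ C)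
    (hFG : ∀ Y, MeasurableSet Y → ∫ x in d ⁻¹' Y, F x ∂μ = ∫ x in d ⁻¹' Y, G x ∂μ)
    {k : Ω → ℝ} (hk : Measurable k) (hki : Integrable (fun x => k (d x)) μ) :
    ∫ x, k (d x) • F x ∂μ = ∫ x, k (d x) • G x ∂μ := by
  have hFi : Integrable F μ := Integrable.of_bound hF C hFC
  have hGi : Integrable G μ := Integrable.of_bound hG C hGC
  have hkF : Integrable (fun x => k (d x) • F x) μ := hki.smul_bdd C hF hFC
  have hkG : Integrable (fun x => k (d x) • G x) μ := hki.smul_bdd C hG hGC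
  have hm : MeasurableSpace.comap d inferInstance ≤ (inferInstance : MeasurableSpace X) := hd.comap_le
  have hk' : AEStronglyMeasurable[MeasurableSpace.comap d inferInstance] (fun x => k (d x)) μ :=
    (hk.comp (comap_measurable d)).stronglyMeasurable.aestronglyMeasurable
  have hce : μ[F | MeasurableSpace.comap d inferInstance]
      =ᵐ[μ] μ[G | MeasurableSpace.comap d inferInstance] := by
    refine ae_eq_condExp_of_forall_setIntegral_eq hm hGi (fun _ _ _ => integrable_condExp.integrableOn)
      ?_ stronglyMeasurable_condExp.aestronglyMeasurable
    rintro _ ⟨Y, hY, rfl⟩ -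
    rw [setIntegral_condExp hm hFi ⟨Y, hY, rfl⟩, hFG Y hY]
  have h1 := condExp_smul_of_aestronglyMeasurable_left hk' hkF hFi
  have h2 := condExp_smul_of_aestronglyMeasurable_left hk' hkG hGi
  rw [← integral_condExp hm (f := fun x => k (d x) • F x),
    ← integral_condExp hm (f := fun x => k (d x) • G x)]
  refine integral_congr_ae (h1.trans (Filter.EventuallyEq.trans ?_ h2.symm))
  filter_upwards [hce] with x hx
  simp only [Pi.smul_apply', hx]

end PullOut

/-! ### Commutative algebras as function spaces -/

section Gelfand

universe u

/-- Gelfand duality. Of the von Neumann algebra property only commutativity and norm closedness are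
used, the latter because a commutant is closed. -/
theorem exists_continuousMap_equiv
    {K : Type u} [NormedAddCommGroup K] [InnerProductSpace ℂ K] [CompleteSpace K]
    {H : Type*} [NormedAddCommGroup H] [InnerProductSpace ℂ H] [CompleteSpace H]
    {N : Submodule ℂ (Op H)} (hN : IsCommVonNeumannAlgebraOn K N) :
    ∃ (X : Type u) (_ : TopologicalSpace X) (_ : CompactSpace X) (_ : T2Space X)
      (ε : C(X, ℂ) ≃ₗᵢ[ℂ] N), (∀ f, (ε (star f) : Op H) = star (ε f : Op H)) ∧
        (ε 1 : Op H) = 1 := by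
  obtain ⟨A, hcomm, e, hstar, hone⟩ := hN
  have hclosed : IsClosed (A.toStarSubalgebra : Set (Op K)) := by
    rw [VonNeumannAlgebra.coe_toStarSubalgebra, ← A.centralizer_centralizer]
    exact Set.isClosed_centralizer _
  let _ : CommCStarAlgebra A.toStarSubalgebra :=
    { StarSubalgebra.cstarAlgebra A.toStarSubalgebra with
      mul_comm := fun a b => Subtype.ext (hcomm a a.2 b b.2) }
  let γ := (gelfandStarTransform A.toStarSubalgebra).symm
  let γ' : C(WeakDual.characterSpace ℂ A.toStarSubalgebra, ℂ) ≃ₗᵢ[ℂ] A.toStarSubalgebra :=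
    { toLinearEquiv := γ.toAlgEquiv.toLinearEquiv
      norm_map' := fun f => StarAlgEquiv.norm_map γ f }
  refine ⟨_, _, inferInstance, inferInstance, γ'.trans e, fun f => ?_, ?_⟩
  · exact (congrArg (fun a => (e a : Op H)) (map_star γ f)).trans (hstar (γ f))
  · exact (congrArg (fun a => (e a : Op H)) (map_one γ)).trans hone

variable {X : Type*} [TopologicalSpace X] [CompactSpace X]
  {H : Type*} [NormedAddCommGroup H] [InnerProductSpace ℂ H] [CompleteSpace H]
  {N : Submodule ℂ (Op H)}

/-- A unital `*`-preserving isometry is positive, because a self-adjoint element `f` of norm at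
most `r` is positive if and only if `‖r - f‖ ≤ r`. -/
theorem isPositive_of_nonneg (ε : C(X, ℂ) ≃ₗᵢ[ℂ] N)
    (hstar : ∀ f, (ε (star f) : Op H) = star (ε f : Op H)) (hone : (ε 1 : Op H) = 1)
    {f : C(X, ℂ)} (hf : ∀ x, 0 ≤ f x) : (ε f : Op H).IsPositive := by
  have hfs : star f = f := by
    ext x
    exact Complex.conj_eq_iff_im.2 (Complex.nonneg_iff.1 (hf x)).2.symm
  have hsa : IsSelfAdjoint (ε f : Op H) := by rw [IsSelfAdjoint, ← hstar, hfs]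
  have hn : ‖(‖f‖ : ℂ) • (1 : Op H) - ε f‖ ≤ ‖f‖ := by
    have h1 : (‖f‖ : ℂ) • (1 : Op H) - ε f = (ε ((‖f‖ : ℂ) • 1 - f) : Op H) := by
      rw [map_sub, map_smul, Submodule.coe_sub, Submodule.coe_smul, hone]
    rw [h1, ← Submodule.coe_norm, ε.norm_map, ContinuousMap.norm_le _ (norm_nonneg _)]
    intro x
    have h2 := f.norm_coe_le_norm x
    have h3 : f x = ((f x).re : ℂ) := Complex.ext rfl (Complex.nonneg_iff.1 (hf x)).2.symm
    have h4 : 0 ≤ (f x).re := (Complex.nonneg_iff.1 (hf x)).1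
    rw [h3, Complex.norm_real, Real.norm_of_nonneg h4] at h2
    have h5 : ((‖f‖ : ℂ) • (1 : C(X, ℂ)) - f) x = ((‖f‖ - (f x).re : ℝ) : ℂ) := by
      rw [ContinuousMap.sub_apply, h3]
      simp
    rw [h5, Complex.norm_real, Real.norm_of_nonneg (sub_nonneg.2 h2)]
    linarith
  refine ContinuousLinearMap.isPositive_def'.2 ⟨hsa, fun v => ?_⟩
  have h1 := re_inner_apply_le ((‖f‖ : ℂ) • (1 : Op H) - (ε f : Op H)) v
  rw [re_inner_smul_one_sub] at h1
  have h2 : ‖(‖f‖ : ℂ) • (1 : Op H) - (ε f : Op H)‖ * ‖v‖ ^ 2 ≤ ‖f‖ * ‖v‖ ^ 2 := by gcongr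
  rw [ContinuousLinearMap.reApplyInnerSelf_apply, inner_re_symm]
  change 0 ≤ (⟪v, (ε f : Op H) v⟫_ℂ).re
  linarith

/-- The inverse of a unital `*`-preserving isometry is positive, by the same norm criterion applied
to the self-adjoint element `f + star f`. -/
theorem re_nonneg_of_accretive (ε : C(X, ℂ) ≃ₗᵢ[ℂ] N)
    (hstar : ∀ f, (ε (star f) : Op H) = star (ε f : Op H)) (hone : (ε 1 : Op H) = 1)
    {f : C(X, ℂ)} (hf : ∀ v, 0 ≤ (⟪v, (ε f : Op H) v⟫_ℂ).re) (x : X) : 0 ≤ (f x).re := by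
  let g := f + star f
  have hg : (ε g : Op H) = ε f + star (ε f : Op H) := by
    rw [← hstar, map_add, Submodule.coe_add]
  have hpos : 0 ≤ (ε g : Op H) := by
    rw [ContinuousLinearMap.nonneg_iff_isPositive, ContinuousLinearMap.isPositive_def', hg]
    refine ⟨IsSelfAdjoint.add_star_self _, fun v => ?_⟩
    rw [ContinuousLinearMap.reApplyInnerSelf_apply, inner_re_symm, add_apply, inner_add_right,
      ContinuousLinearMap.star_eq_adjoint, ContinuousLinearMap.adjoint_inner_right, map_add,
      inner_re_symm _ v]
    exact add_nonneg (hf v) (hf v)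
  have hn : ‖(‖g‖ : ℂ) • (1 : C(X, ℂ)) - g‖ ≤ ‖g‖ := by
    have h1 : (ε ((‖g‖ : ℂ) • 1 - g) : Op H) = algebraMap ℝ (Op H) ‖(ε g : Op H)‖ - ε g := by
      rw [map_sub, map_smul, Submodule.coe_sub, Submodule.coe_smul, hone, ← Submodule.coe_norm,
        ε.norm_map, Algebra.algebraMap_eq_smul_one]
      rfl
    rw [← ε.norm_map, Submodule.coe_norm, h1, ← ε.norm_map g, Submodule.coe_norm]
    have h2 := IsSelfAdjoint.le_algebraMap_norm_self (IsSelfAdjoint.of_nonneg hpos)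
    refine (CStarAlgebra.norm_le_norm_of_nonneg_of_le (sub_nonneg.2 h2)
      (sub_le_self _ hpos)).trans ?_
    rw [Algebra.algebraMap_eq_smul_one, norm_smul, norm_norm]
    exact mul_le_of_le_one_right (norm_nonneg _) ContinuousLinearMap.norm_id_le
  have h1 := (ContinuousMap.norm_coe_le_norm _ x).trans hn
  have h2 : ((‖g‖ : ℂ) • (1 : C(X, ℂ)) - g) x = ((‖g‖ - 2 * (f x).re : ℝ) : ℂ) := by
    have : g x = ((2 * (f x).re : ℝ) : ℂ) := Complex.add_conj (f x)
    rw [ContinuousMap.sub_apply, this]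
    simp
  rw [h2, Complex.norm_real, Real.norm_eq_abs] at h1
  linarith [(abs_le.1 h1).2]

end Gelfand

/-! ### The response of a commutative algebra -/

section Assembly

variable {X : Type*} [TopologicalSpace X] [CompactSpace X] [T2Space X] [MeasurableSpace X]
  [BorelSpace X]
  {H : Type*} [NormedAddCommGroup H] [InnerProductSpace ℂ H] [CompleteSpace H]

theorem integrable_continuousMap (μ : Measure X) [IsFiniteMeasure μ] (f : C(X, ℂ)) :
    Integrable f μ :=
  f.continuous.integrable_of_hasCompactSupport (HasCompactSupport.of_compactSpace _)

theorem integrable_apply_simpleFunc {Ω : Type*} [MeasurableSpace Ω] (μ : Measure X)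
    [IsFiniteMeasure μ] {d : X → Ω} (hd : Measurable d) (Ψ : Op H →ₗ[ℂ] C(X, ℂ))
    (F : SimpleFunc Ω (Op H)) : Integrable (fun x => Ψ (F (d x)) x) μ := by
  induction F using SimpleFunc.induction with
  | @const a s hs =>
    refine ((integrable_continuousMap μ (Ψ a)).indicator (hd hs)).congr (ae_of_all _ fun x => ?_)
    by_cases hx : d x ∈ s <;> simp [Set.indicator, Set.piecewise, hx]
  | add _ hF hG =>
    refine (hF.add hG).congr (ae_of_all _ fun x => ?_)
    simp

/-- The functional `F ↦ Re ∫ Ψ(F(d x))(x) dμ(x)` on the operator valued simple functions. -/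
noncomputable def simpleFuncFunctional {Ω : Type*} [MeasurableSpace Ω] (μ : Measure X)
    [IsFiniteMeasure μ] {d : X → Ω} (hd : Measurable d) (Ψ : Op H →ₗ[ℂ] C(X, ℂ)) :
    SimpleFunc Ω (Op H) →ₗ[ℝ] ℝ where
  toFun F := (∫ x, Ψ (F (d x)) x ∂μ).re
  map_add' F G := by
    rw [← Complex.add_re, ← integral_add (integrable_apply_simpleFunc μ hd Ψ F)
      (integrable_apply_simpleFunc μ hd Ψ G)]
    simp
  map_smul' c F := by
    have h : ∀ x, Ψ ((c • F) (d x)) x = (c : ℂ) * Ψ (F (d x)) x := fun x => by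
      have : (c • F) (d x) = (c : ℂ) • F (d x) := rfl
      rw [this, map_smul]
      rfl
    simp only [h]
    rw [integral_const_mul, Complex.re_ofReal_mul]
    rfl

theorem simpleFuncFunctional_indicatorOp {Ω : Type*} [MeasurableSpace Ω] (μ : Measure X)
    [IsFiniteMeasure μ] {d : X → Ω} (hd : Measurable d) (Ψ : Op H →ₗ[ℂ] C(X, ℂ)) {Y : Set Ω}
    (hY : MeasurableSet Y) (a : Op H) :
    simpleFuncFunctional μ hd Ψ (indicatorOp Y hY a) = (∫ x in d ⁻¹' Y, Ψ a x ∂μ).re := by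
  rw [← integral_indicator (hd hY)]
  refine congrArg Complex.re (integral_congr_ae (ae_of_all _ fun x => ?_))
  simp only [indicatorOp_apply]
  by_cases hx : d x ∈ Y <;> simp [hx]

/-- The measures of an operator valued measure are absolutely continuous with respect to the
distribution in a faithful state. -/
theorem absolutelyContinuous_of_faithful {Ω : Type*} [MeasurableSpace Ω] {m : H → Measure Ω}
    {E : Set Ω → Op H} (hm : ∀ v, m v Set.univ = ENNReal.ofReal (‖v‖ ^ 2))
    (hE : ∀ B, MeasurableSet B → ∀ v, ⟪v, E B v⟫_ℂ = (m v).real B) {ρ : State H}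
    (hρ : ρ.Faithful) {μ : Measure Ω}
    (hμ : ∀ B, MeasurableSet B → trace (ρ.op * E B) = ((μ.real B : ℝ) : ℂ)) (v : H) : m v ≪ μ := by
  have hfin : ∀ v, IsFiniteMeasure (m v) := fun v => ⟨by simp [hm]⟩
  refine Measure.AbsolutelyContinuous.mk fun B hB hB0 => ?_
  have hpos : (E B).IsPositive := by
    rw [ContinuousLinearMap.isPositive_iff_complex]
    intro w
    have h : ⟪E B w, w⟫_ℂ = (m w).real B := by
      rw [← inner_conj_symm, hE B hB, Complex.conj_ofReal]
    rw [h]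
    exact ⟨by simp, measureReal_nonneg⟩
  have h0 := hρ _ hpos (by rw [hμ B hB, Measure.real, hB0]; simp)
  have h1 := hE B hB v
  rw [h0, zero_apply, inner_zero_right] at h1
  have h2 : (m v).real B = 0 := by exact_mod_cast h1.symm
  exact (measureReal_eq_zero_iff).1 h2

/-- The composite `∫ T(a) dG` of the response with the POVM is the identity on `N`, tested on
the vector `v`. -/
theorem integral_response_eq_inner [TopologicalSpace.SeparableSpace H]
    {Φ : C(X, ℂ) → Op H} {m : H → Measure X} {E : Set X → Op H}
    (hm : ∀ v, m v Set.univ = ENNReal.ofReal (‖v‖ ^ 2))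
    (hE : ∀ B, MeasurableSet B → ∀ v, ⟪v, E B v⟫_ℂ = (m v).real B)
    (hint : ∀ (f : C(X, ℂ)) v, ∫ x, f x ∂(m v) = ⟪v, Φ f v⟫_ℂ)
    {μ : Measure X} [IsFiniteMeasure μ] (hac : ∀ v, m v ≪ μ)
    {d : X → ℕ → ENNReal}
    (hd : d = fun x n => (m (TopologicalSpace.denseSeq H n)).rnDeriv μ x) (hdm : Measurable d)
    {f : C(X, ℂ)} {h : (ℕ → ENNReal) → ℂ} (hh : StronglyMeasurable h) {C : ℝ}
    (hC : ∀ᵐ y ∂(μ.map d), ‖h y‖ ≤ C)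
    (hfh : ∀ Y, MeasurableSet Y → ∫ y in Y, h y ∂(μ.map d) = ∫ x in d ⁻¹' Y, f x ∂μ) (v : H) :
    ∫ y, h y ∂((m v).map d) = ⟪v, Φ f v⟫_ℂ := by
  have hfin : ∀ v, IsFiniteMeasure (m v) := fun v => ⟨by simp [hm]⟩
  have hcont : Continuous fun v => ∫ x, h (d x) ∂(m v) :=
    continuous_integral hm hE (hh.comp_measurable hdm) (C := C) fun v =>
      (hac v).ae_le (ae_of_ae_map hdm.aemeasurable hC)
  have hcont' : Continuous fun v => ⟪v, Φ f v⟫_ℂ := by fun_prop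
  have heq : (fun v => ∫ x, h (d x) ∂(m v)) = fun v => ⟪v, Φ f v⟫_ℂ := by
    refine hcont.ext_on (TopologicalSpace.denseRange_denseSeq H) hcont' ?_
    rintro _ ⟨n, rfl⟩
    set w := TopologicalSpace.denseSeq H n
    have hdn : ∀ x, d x n = (m w).rnDeriv μ x := fun x => by rw [hd]
    have hk : Measurable fun y : ℕ → ENNReal => (y n).toReal := (measurable_pi_apply n).ennreal_toReal
    have hrn : ∀ F : X → ℂ, ∫ x, F x ∂(m w) = ∫ x, (d x n).toReal • F x ∂μ := fun F => by
      simp only [hdn]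
      exact (integral_rnDeriv_smul (hac w)).symm
    change ∫ x, h (d x) ∂(m w) = ⟪w, Φ f w⟫_ℂ
    rw [← hint f w, hrn, hrn]
    refine integral_comp_smul_eq hdm (C := max C ‖f‖) (k := fun y => (y n).toReal)
      (hh.comp_measurable hdm).aestronglyMeasurable ?_
      (integrable_continuousMap μ f).aestronglyMeasurable
      (ae_of_all _ fun x => (f.norm_coe_le_norm x).trans (le_max_right _ _)) (fun Y hY => ?_) hk ?_
    · exact (ae_of_ae_map hdm.aemeasurable hC).mono fun x hx => hx.trans (le_max_left _ _)
    · rw [← hfh Y hY, setIntegral_map hY hh.aestronglyMeasurable hdm.aemeasurable]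
      rfl
    · simp only [hdn]
      exact Measure.integrable_toReal_rnDeriv
  rw [integral_map hdm.aemeasurable hh.aestronglyMeasurable]
  exact congrFun heq v

/-- The construction of the POVM and of the response from an isometry `ε` of `C(X)` onto `N`. The
POVM is the image of the operator valued measure of `ε` under the sequence `d` of densities. -/
theorem nonNormalNonConfirming_of_equiv [TopologicalSpace.SeparableSpace H] [Nontrivial H]
    {N : Submodule ℂ (Op H)} (ε : C(X, ℂ) ≃ₗᵢ[ℂ] N)
    (hstar : ∀ f, (ε (star f) : Op H) = star (ε f : Op H)) (hone : (ε 1 : Op H) = 1)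
    {ℳ : Set (Observable H)} (hℳ : effects ℳ ⊆ N) : NonNormalNonConfirming ℳ := by
  have h1N : (1 : Op H) ∈ N := hone ▸ (ε 1).2
  -- an arbitrary linear extension of `ε⁻¹`, whose values outside of `N` do not matter
  obtain ⟨Ψ, hΨ⟩ := LinearMap.exists_extend (p := N) (ε.symm : N →ₗ[ℂ] C(X, ℂ))
  have hΨN : ∀ a (ha : a ∈ N), Ψ a = ε.symm ⟨a, ha⟩ := fun a ha => LinearMap.congr_fun hΨ ⟨a, ha⟩
  have hΨε : ∀ a ∈ N, (ε (Ψ a) : Op H) = a := fun a ha => by rw [hΨN a ha]; simp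
  have hΨ1 : Ψ 1 = 1 := ε.injective (Subtype.ext (by rw [hΨε 1 h1N, hone]))
  obtain ⟨m, E, hm, hE, hint⟩ := exists_effects (N.subtype.comp (ε : C(X, ℂ) →ₗ[ℂ] N))
    (fun f hf => isPositive_of_nonneg ε hstar hone hf) hone
  obtain ⟨ρ₀, hρ₀⟩ := State.exists_faithful (H := H)
  obtain ⟨u₀, hμprob, -, hμ⟩ := ρ₀.exists_sum_measure hm hE
  set μ := Measure.sum fun i => m (u₀ i)
  have hac := absolutelyContinuous_of_faithful hm hE hρ₀ hμ
  let d : X → ℕ → ENNReal := fun x n => (m (TopologicalSpace.denseSeq H n)).rnDeriv μ x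
  have hd : Measurable d := measurable_pi_lambda _ fun n => Measure.measurable_rnDeriv _ _
  have hm' : ∀ v, (m v).map d Set.univ = ENNReal.ofReal (‖v‖ ^ 2) := fun v => by
    rw [Measure.map_apply hd MeasurableSet.univ, Set.preimage_univ, hm]
  have hE' : ∀ Y, MeasurableSet Y → ∀ v, ⟪v, E (d ⁻¹' Y) v⟫_ℂ = ((m v).map d).real Y :=
    fun Y hY v => by rw [hE _ (hd hY), map_measureReal_apply hd hY]
  let G : POVM H (ℕ → ENNReal) := ⟨fun Y => E (d ⁻¹' Y), fun ρ => by
    obtain ⟨u, hu, -, hρ⟩ := ρ.exists_sum_measure hm' hE'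
    exact ⟨_, hu, hρ⟩⟩
  have hG₀ : G.measure ρ₀ = μ.map d := G.measure_eq ρ₀ fun Y hY => by
    rw [map_measureReal_apply hd hY]
    exact hμ _ (hd hY)
  have hprob := G.isProbabilityMeasure_measure ρ₀
  obtain ⟨T, hTpos, hT1, hT⟩ := exists_response (ν := G.measure ρ₀) N h1N
    (simpleFuncFunctional μ hd Ψ)
    (fun F hF hFN => by
      refine (integral_nonneg fun x => ?_).trans_eq
        (integral_re (integrable_apply_simpleFunc μ hd Ψ F))
      refine re_nonneg_of_accretive ε hstar hone (fun v => ?_) x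
      rw [hΨε _ (hFN _)]
      exact hF _ v)
    (fun Y hY => by
      rw [simpleFuncFunctional_indicatorOp, hΨ1, hG₀, map_measureReal_apply hd hY]
      simp)
  have hTset : ∀ a ∈ N, ∀ Y, MeasurableSet Y →
      ∫ y in Y, T a y ∂(μ.map d) = ∫ x in d ⁻¹' Y, Ψ a x ∂μ := fun a ha Y hY => by
    rw [← hG₀]
    apply Complex.ext
    · rw [hT a ha Y hY, simpleFuncFunctional_indicatorOp]
    · -- the imaginary parts are the real parts for `-i a`
      have h1 := hT _ (N.smul_mem (-Complex.I) ha) Y hY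
      rw [simpleFuncFunctional_indicatorOp, map_smul, map_smul, setIntegral_congr_ae hY
        ((Lp.coeFn_smul (-Complex.I) (T a)).mono fun x hx _ => hx)] at h1
      simp only [Pi.smul_apply, ContinuousMap.smul_apply, smul_eq_mul] at h1
      rw [integral_const_mul, integral_const_mul] at h1
      simpa using h1
  have hTv : ∀ a ∈ N, ∀ v, ∫ y, T a y ∂((m v).map d) = ⟪v, a v⟫_ℂ := fun a ha v => by
    have h1 := integral_response_eq_inner hm hE hint hac rfl hd (Lp.stronglyMeasurable (T a))
      (C := ‖T a‖) (hG₀ ▸ Lp_top_ae_norm_le (T a)) (hTset a ha) v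
    rw [h1]
    change ⟪v, (ε (Ψ a) : Op H) v⟫_ℂ = _
    rw [hΨε a ha]
  refine ⟨ℕ → ENNReal, inferInstance, inferInstance, G, ρ₀, hρ₀, ⟨T, hTpos, hT1⟩,
    fun M hM ρ B hB => ?_⟩
  have ha : M.povm.effect B ∈ N := hℳ ⟨M, hM, B, hB, rfl⟩
  set a := M.povm.effect B
  obtain ⟨u, hu, huA, hρ⟩ := ρ.exists_sum_measure hm' hE'
  rw [G.measure_eq ρ hρ, ← (huA a).tsum_eq]
  have hac' : (Measure.sum fun i => (m (u i)).map d) ≪ G.measure ρ₀ := by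
    rw [hG₀]
    exact Measure.absolutelyContinuous_sum_left fun i => (hac (u i)).map hd
  rw [integral_sum_measure (Integrable.of_bound (Lp.stronglyMeasurable (T a)).aestronglyMeasurable
    ‖T a‖ (hac'.ae_le (Lp_top_ae_norm_le (T a))))]
  exact tsum_congr fun i => (hTv a ha (u i)).symm

end Assembly

end Contextuality


theorem mainTheorem11
    {H : Type*} [NormedAddCommGroup H] [InnerProductSpace ℂ H] [CompleteSpace H]
    [TopologicalSpace.SeparableSpace H] [Nontrivial H]
    {K : Type*} [NormedAddCommGroup K] [InnerProductSpace ℂ K] [CompleteSpace K]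
    [TopologicalSpace.SeparableSpace K]
    (N : Submodule ℂ (Contextuality.Op H)) (hN : Contextuality.IsCommVonNeumannAlgebraOn K N)
    (ℳ : Set (Contextuality.Observable H)) (hℳ : Contextuality.effects ℳ ⊆ N) :
    Contextuality.NonNormalNonConfirming ℳ := by
  obtain ⟨X, _, _, _, ε, hstar, hone⟩ := Contextuality.exists_continuousMap_equiv hN
  borelize X
  exact Contextuality.nonNormalNonConfirming_of_equiv ε hstar hone hℳ
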